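/- Let $\mathcal U\subseteq\{-1,0,1\}\setminus\{0\}$, $\mathcal V\subseteq\{-1,0,1\}$ and $\mathcal T\subseteq\{-1,0,1\}^2\setminus\{(0,0)\}$, and let $\mathcal S\subseteq\{-1,0,1\}^3\setminus\{(0,0,0)\}$ be the $(1,2)$-Hadamard step set $$\mathcal S=\left(\mathcal U\times\{0\}^2\right)\cup\left(\mathcal V\times\mathcal T\right).$$ All walks start at the origin, and $\mathbb N=\{0,1,2,\dots\}$. A coloured $(\mathcal U,\mathcal V)$-walk is a walk on $\mathbb N$ with steps in $\mathcal U\cup\mathcal V$, each step being coloured black or white, such that all steps of $\mathcal U\setminus\mathcal V$ are white and all steps of $\mathcal V\setminus\mathcal U$ are black. Define * $C_1(x,v;t)=\sum_{i,k,n\ge 0} c_1(i,k;n)\,x^iv^kt^n$, where $c_1(i,k;n)$ is the number of coloured $(\mathcal U,\mathcal V)$-walks with $n$ steps, exactly $k$ of them black, that end at $i$; * $C_2(y,z;t)=\sum_{j,k,n\ge 0} c_2(j,k;n)\,y^jz^kt^n$, where $c_2(j,k;n)$ is the number of $n$-step walks with steps in $\mathcal T$ that stay in the quadrant $\mathbb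 N^2$ and end at $(j,k)$; * $O(x,y,z;t)=\sum_{i,j,k,n\ge 0} o(i,j,k;n)\,x^iy^jz^kt^n$, where $o(i,j,k;n)$ is the number of $n$-step walks with steps in $\mathcal S$ that stay in the octant $\mathbb N^3$ and end at $(i,j,k)$. A formal power series $F(x_1,\dots,x_r)$ with rational coefficients is algebraic if $P(x_1,\dots,x_r,F)=0$ for some non-zero polynomial $P\in\mathbb Q[x_1,\dots,x_r,s]$. It is D-finite (in all its variables) if for each $i$ the vector space over $\mathbb Q(x_1,\dots,x_r)$ spanned by the iterated derivatives $\partial^m F/\partial x_i^m$, $m\ge 0$, has finite dimension. Then: 1. the series $C_1(x,v;t)$ is algebraic; 2. if the series $C_2(y,z;t)$ is D-finite, then the series $O(x,y,z;t)$ is D-finite. -/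

import Mathlib

namespace OctantWalks

/-- The set `{-1, 0, 1}^D` of small steps. -/
def smallSteps (D : ℕ) : Set (Fin D → ℤ) :=
  {s | ∀ i, s i ∈ ({-1, 0, 1} : Set ℤ)}

/-- Walks (given as their lists of steps) that start at the origin, take all their steps in `S`
and stay in the orthant `ℕ^D`: the point reached after every initial segment is nonnegative. -/
def orthantWalks {D : ℕ} (S : Set (Fin D → ℤ)) : Set (List (Fin D → ℤ)) :=
  {w | (∀ s ∈ w, s ∈ S) ∧ ∀ p, p <+: w → 0 ≤ p.sum}

/-- The number of `n`-step walks with steps in `S`, confined to `ℕ^D`, that end at `e`. -/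
noncomputable def walkCount {D : ℕ} (S : Set (Fin D → ℤ)) (e : Fin D → ℕ) (n : ℕ) : ℕ :=
  {w | w ∈ orthantWalks S ∧ w.length = n ∧ w.sum = fun i => (e i : ℤ)}.ncard

/-- The generating function `∑ o(e; n) x₁^{e₁} ⋯ x_D^{e_D} t^n` of walks confined to `ℕ^D`.
The variable `Sum.inl i` is `x_i`, and `Sum.inr ()` is the length variable `t`. -/
noncomputable def walkGF {D : ℕ} (S : Set (Fin D → ℤ)) : MvPowerSeries (Fin D ⊕ Unit) ℚ :=
  fun m => (walkCount S (fun i => m (Sum.inl i)) (m (Sum.inr ())) : ℚ)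

/-- Coloured `(U, V)`-walks. A coloured step is a pair of a step of `U ∪ V` and a colour,
`true` for black and `false` for white; steps of `U \ V` are white, and steps of `V \ U` are
black. The walk, without its colours, is confined to `ℕ^d`. -/
def colouredWalks {d : ℕ} (U V : Set (Fin d → ℤ)) : Set (List ((Fin d → ℤ) × Bool)) :=
  {w | w.map Prod.fst ∈ orthantWalks (U ∪ V) ∧
    ∀ s ∈ w, (s.1 ∈ U \ V → s.2 = false) ∧ (s.1 ∈ V \ U → s.2 = true)}

/-- The number of coloured `(U, V)`-walks with `n` steps, `k` of them black, that end at `e`. -/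
noncomputable def colouredCount {d : ℕ} (U V : Set (Fin d → ℤ)) (e : Fin d → ℕ) (k n : ℕ) : ℕ :=
  {w | w ∈ colouredWalks U V ∧ w.length = n ∧ (w.map Prod.snd).count true = k ∧
    (w.map Prod.fst).sum = fun i => (e i : ℤ)}.ncard

/-- The generating function `C₁(x₁, …, x_d, v; t)` of coloured `(U, V)`-walks. The variable
`Sum.inl i` is `x_i`, `Sum.inr 0` is `v` (number of black steps), `Sum.inr 1` is `t` (length). -/
noncomputable def colouredGF {d : ℕ} (U V : Set (Fin d → ℤ)) :
    MvPowerSeries (Fin d ⊕ Fin 2) ℚ :=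
  fun m => (colouredCount U V (fun i => m (Sum.inl i)) (m (Sum.inr 0)) (m (Sum.inr 1)) : ℚ)

/-- The step set `(U × {0}^δ) ∪ (V × T)`. -/
def hadamardSteps {d δ : ℕ} (U V : Set (Fin d → ℤ)) (T : Set (Fin δ → ℤ)) :
    Set (Fin (d + δ) → ℤ) :=
  Set.image2 Fin.append U {0} ∪ Set.image2 Fin.append V T

/-- The field of rational functions `ℚ(x_i : i ∈ σ)`, inside the fraction field of the ring of
formal power series in the same variables. -/
noncomputable abbrev ratFunField (σ : Type) :
    IntermediateField ℚ (FractionRing (MvPowerSeries σ ℚ)) :=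
  IntermediateField.adjoin ℚ (Set.range fun i : σ =>
    algebraMap (MvPowerSeries σ ℚ) (FractionRing (MvPowerSeries σ ℚ)) (MvPowerSeries.X i))

/-- `F` is D-finite with respect to the variable `i`: the iterated partial derivatives
`D_i^m F`, `m ≥ 0`, span a finite-dimensional vector space over the field of rational functions
in all the variables. -/
def DFiniteWrt {σ : Type} (i : σ) (F : MvPowerSeries σ ℚ) : Prop :=
  FiniteDimensional (ratFunField σ)
    (Submodule.span (ratFunField σ) (Set.range fun m : ℕ =>
      algebraMap (MvPowerSeries σ ℚ) (FractionRing (MvPowerSeries σ ℚ))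
        ((MvPowerSeries.pderiv ℚ i)^[m] F)))

/-- `F` is D-finite (in all its variables): it is D-finite with respect to each of them. -/
def DFinite {σ : Type} (F : MvPowerSeries σ ℚ) : Prop :=
  ∀ i, DFiniteWrt i F

end OctantWalks

/-! Colour a step of an octant walk black if it comes from $\mathcal V\times\mathcal T$ and white if
it comes from $\mathcal U\times\{0\}^2$; as $0\notin\mathcal T$, the colour is determined. The first
coordinate is then a coloured walk, and the other two coordinates of the black steps form a quadrant
walk whose length is the number of black steps. Hence $o(i,j,k;n)=\sum_m c_1(i,m;n)\,c_2(j,k;m)$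
(`intWalkCount_hadamardSteps`).

Let $W(x,s;t)$ count coloured walks with $s$ marking white steps. In $W(x,s;t)\,C_2(y,z;s)$ the
exponents of $s$ and $t$ agree exactly when the quadrant walk is as long as the number of black
steps, so $O$ is a diagonal of this product (`walkGF_hadamardSteps`).

Both $C_1$ and $W$ are algebraic by the kernel method for half-line walks with steps $-1,0,1$
(`isAlgebraic_of_kernel_equation`). Algebraic series are D-finite (`Holonomic.of_isAlgebraic`),
products of D-finite series are D-finite (`Holonomic.mul`), and so are diagonals
(`Holonomic.dFinite_diagonal`). The last fact is proved by a dimension count in the style of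
Lipshitz: differential operators adapted to the diagonal outnumber the dimension of the space into
which they send the series, so some nontrivial combination annihilates it.

Closure properties are proved for `Holonomic`: finitely generated polynomial modules inside the
power series, stable under derivation up to denominators. `DFinite.holonomic` enters this setting,
and `DFiniteWrt.of_relation` leaves it. -/

namespace OctantWalks

open MvPowerSeries

/-! ### Polynomial modules up to denominators. -/

section Saturation

variable {σ : Type}

theorem polyAlgebraMap_eq_coe (p : MvPolynomial σ ℚ) :
    algebraMap (MvPolynomial σ ℚ) (MvPowerSeries σ ℚ) p = (p : MvPowerSeries σ ℚ) := by
  ext n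
  simp [MvPowerSeries.algebraMap_apply']

theorem poly_smul_eq (p : MvPolynomial σ ℚ) (h : MvPowerSeries σ ℚ) :
    p • h = (p : MvPowerSeries σ ℚ) * h := by
  rw [Algebra.smul_def, polyAlgebraMap_eq_coe]

theorem pderiv_poly_smul (i : σ) (p : MvPolynomial σ ℚ) (h : MvPowerSeries σ ℚ) :
    pderiv ℚ i (p • h) = p • pderiv ℚ i h + MvPolynomial.pderiv i p • h := by
  simp only [poly_smul_eq, Derivation.leibniz, smul_eq_mul, pderiv_coe]
  ring

theorem pderiv_comm (i j : σ) (h : MvPowerSeries σ ℚ) :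
    pderiv ℚ i (pderiv ℚ j h) = pderiv ℚ j (pderiv ℚ i h) := by
  classical
  ext n
  simp only [coeff_pderiv, Finsupp.add_apply]
  rw [add_right_comm n]
  by_cases hij : i = j
  · subst hij; rfl
  · rw [Finsupp.single_eq_of_ne hij, Finsupp.single_eq_of_ne (Ne.symm hij)]
    push_cast
    ring

/-- The series that lie in `N` after multiplication by some nonzero polynomial. -/
def saturation (N : Submodule (MvPolynomial σ ℚ) (MvPowerSeries σ ℚ)) :
    Submodule (MvPolynomial σ ℚ) (MvPowerSeries σ ℚ) where
  carrier := {h | ∃ q : MvPolynomial σ ℚ, q ≠ 0 ∧ q • h ∈ N}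
  zero_mem' := ⟨1, one_ne_zero, by simp⟩
  add_mem' := by
    rintro a b ⟨p, hp, hpa⟩ ⟨q, hq, hqb⟩
    refine ⟨p * q, mul_ne_zero hp hq, ?_⟩
    rw [smul_add]
    refine N.add_mem ?_ ?_
    · rw [mul_comm, mul_smul]; exact N.smul_mem _ hpa
    · rw [mul_smul]; exact N.smul_mem _ hqb
  smul_mem' := by
    rintro c a ⟨p, hp, hpa⟩
    refine ⟨p, hp, ?_⟩
    rw [smul_comm]
    exact N.smul_mem _ hpa

variable {N N' : Submodule (MvPolynomial σ ℚ) (MvPowerSeries σ ℚ)}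

theorem le_saturation : N ≤ saturation N := fun _ h => ⟨1, one_ne_zero, by simpa using h⟩

theorem saturation_mono (h : N ≤ N') : saturation N ≤ saturation N' :=
  fun _ ⟨q, hq, hm⟩ => ⟨q, hq, h hm⟩

theorem mem_saturation_of_smul {q : MvPolynomial σ ℚ} (hq : q ≠ 0) {h : MvPowerSeries σ ℚ}
    (hm : q • h ∈ saturation N) : h ∈ saturation N := by
  obtain ⟨p, hp, hpm⟩ := hm
  exact ⟨p * q, mul_ne_zero hp hq, by rwa [mul_smul]⟩

theorem saturation_le (h : N ≤ saturation N') : saturation N ≤ saturation N' :=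
  fun _ ⟨_, hq, hm⟩ => mem_saturation_of_smul hq (h hm)

theorem pderiv_mem_span {i : σ} {s : Set (MvPowerSeries σ ℚ)} (hs : s ⊆ N)
    (hN : ∀ h ∈ s, pderiv ℚ i h ∈ N) {h : MvPowerSeries σ ℚ}
    (hh : h ∈ Submodule.span (MvPolynomial σ ℚ) s) : pderiv ℚ i h ∈ N := by
  induction hh using Submodule.span_induction with
  | mem x hx => exact hN x hx
  | zero => simp
  | add x y _ _ hx hy => rw [map_add]; exact N.add_mem hx hy
  | smul a x hx ih =>
    rw [pderiv_poly_smul]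
    exact N.add_mem (N.smul_mem _ ih) (N.smul_mem _ (Submodule.span_le.2 hs hx))

/-- Quotient rule: $q\,\partial h=\partial(qh)-(\partial q)h$, and a saturation permits division by
$q$. -/
theorem pderiv_mem_saturation {i : σ} (hle : N ≤ saturation N')
    (hN : ∀ h ∈ N, pderiv ℚ i h ∈ saturation N') {h : MvPowerSeries σ ℚ}
    (hh : h ∈ saturation N) : pderiv ℚ i h ∈ saturation N' := by
  have hh' := saturation_le hle hh
  obtain ⟨q, hq, hm⟩ := hh
  have h1 := hN _ hm
  rw [pderiv_poly_smul] at h1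
  exact mem_saturation_of_smul hq
    ((Submodule.add_mem_iff_left _ ((saturation N').smul_mem _ hh')).1 h1)

/-- `F` belongs to a finitely generated module over the polynomials which is closed under all
partial derivatives, up to denominators. -/
def Holonomic (F : MvPowerSeries σ ℚ) : Prop :=
  ∃ N : Submodule (MvPolynomial σ ℚ) (MvPowerSeries σ ℚ), N.FG ∧ F ∈ N ∧
    ∀ i, ∀ h ∈ N, pderiv ℚ i h ∈ saturation N

theorem Holonomic.mul {F G : MvPowerSeries σ ℚ} (hF : Holonomic F) (hG : Holonomic G) :
    Holonomic (F * G) := by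
  obtain ⟨N, hN, hFN, hdN⟩ := hF
  obtain ⟨M, hM, hGM, hdM⟩ := hG
  refine ⟨N * M, hN.mul hM, Submodule.mul_mem_mul hFN hGM, fun i h hh => ?_⟩
  induction hh using Submodule.mul_induction_on' with
  | mem_mul_mem x hx y hy =>
    rw [Derivation.leibniz, smul_eq_mul, smul_eq_mul]
    obtain ⟨p, hp, hpx⟩ := hdN i x hx
    obtain ⟨q, hq, hqy⟩ := hdM i y hy
    refine (saturation _).add_mem ⟨q, hq, ?_⟩ ⟨p, hp, ?_⟩
    · rw [← mul_smul_comm]; exact Submodule.mul_mem_mul hx hqy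
    · rw [mul_comm y, ← smul_mul_assoc]; exact Submodule.mul_mem_mul hpx hy
  | add x _ y _ hx hy => rw [map_add]; exact (saturation _).add_mem hx hy

end Saturation

/-! ### Adding variables on which a series does not depend. -/

section Rename

variable {σ τ : Type} (e : σ ↪ τ)

theorem coeff_rename_eq_zero_of_ne {F : MvPowerSeries σ ℚ} {m : τ →₀ ℕ} {j : τ}
    (hj : j ∉ Set.range e) (hm : m j ≠ 0) : coeff m (rename e F) = 0 := by
  refine coeff_rename_eq_zero _ _ ?_
  rintro ⟨x, rfl⟩
  exact hm (Finsupp.mapDomain_of_notMem_range _ _ hj)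

theorem exists_embDomain_eq {m : τ →₀ ℕ} (hm : ∀ j ∉ Set.range e, m j = 0) :
    ∃ x : σ →₀ ℕ, x.embDomain e = m := by
  refine ⟨m.comapDomain e e.injective.injOn, ?_⟩
  rw [Finsupp.embDomain_eq_mapDomain]
  refine Finsupp.mapDomain_comapDomain _ e.injective _ fun j hj => ?_
  by_contra h
  exact (Finsupp.mem_support_iff.1 hj) (hm j h)

theorem pderiv_rename_of_notMem {j : τ} (hj : j ∉ Set.range e) (F : MvPowerSeries σ ℚ) :
    pderiv ℚ j (rename e F) = 0 := by
  ext m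
  rw [coeff_pderiv, coeff_rename_eq_zero_of_ne e hj (by simp)]
  simp

theorem pderiv_rename (i : σ) (F : MvPowerSeries σ ℚ) :
    pderiv ℚ (e i) (rename e F) = rename e (pderiv ℚ i F) := by
  ext m
  rw [coeff_pderiv]
  by_cases hm : ∀ j ∉ Set.range e, m j = 0
  · obtain ⟨x, rfl⟩ := exists_embDomain_eq e hm
    rw [← Finsupp.embDomain_single, ← Finsupp.embDomain_add, coeff_embDomain_rename,
      coeff_embDomain_rename, coeff_pderiv, Finsupp.embDomain_apply_self]
  · push Not at hm
    obtain ⟨j, hj, hmj⟩ := hm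
    rw [coeff_rename_eq_zero_of_ne e hj hmj, coeff_rename_eq_zero_of_ne e hj, zero_mul]
    simp only [Finsupp.add_apply]
    omega

theorem rename_mem_span {s : Set (MvPowerSeries σ ℚ)} {h : MvPowerSeries σ ℚ}
    (hh : h ∈ Submodule.span (MvPolynomial σ ℚ) s) :
    rename e h ∈ Submodule.span (MvPolynomial τ ℚ) (rename e '' s) := by
  induction hh using Submodule.span_induction with
  | mem x hx => exact Submodule.subset_span ⟨x, hx, rfl⟩
  | zero => simp
  | add x y _ _ hx hy => rw [map_add]; exact Submodule.add_mem _ hx hy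
  | smul a x hx ih =>
    rw [poly_smul_eq, map_mul, rename_coe, ← poly_smul_eq]
    exact Submodule.smul_mem _ _ ih

theorem pderiv_rename_mem_saturation {s : Set (MvPowerSeries σ ℚ)} {x : MvPowerSeries σ ℚ}
    (hx : ∀ i, pderiv ℚ i x ∈ saturation (Submodule.span (MvPolynomial σ ℚ) s)) (j : τ) :
    pderiv ℚ j (rename e x) ∈
      saturation (Submodule.span (MvPolynomial τ ℚ) (rename e '' s)) := by
  by_cases hj : j ∈ Set.range e
  · obtain ⟨i, rfl⟩ := hj
    rw [pderiv_rename]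
    obtain ⟨q, hq, hm⟩ := hx i
    refine ⟨MvPolynomial.rename e q, ?_, ?_⟩
    · rwa [Ne, map_eq_zero_iff _ (MvPolynomial.rename_injective _ e.injective)]
    · rw [poly_smul_eq, ← rename_coe (f := e), ← map_mul, ← poly_smul_eq]
      exact rename_mem_span e hm
  · rw [pderiv_rename_of_notMem e hj]
    exact Submodule.zero_mem _

theorem holonomic_rename {F : MvPowerSeries σ ℚ} (hF : Holonomic F) :
    Holonomic (rename e F) := by
  obtain ⟨N, ⟨s, rfl⟩, hFN, hdN⟩ := hF
  refine ⟨_, Submodule.fg_span (s.finite_toSet.image (rename e)), rename_mem_span e hFN,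
    fun j h hh => ?_⟩
  refine pderiv_mem_span (Submodule.subset_span.trans le_saturation) ?_ hh
  rintro _ ⟨x, hx, rfl⟩
  exact pderiv_rename_mem_saturation e (fun i => hdN i x (Submodule.subset_span hx)) j

end Rename

/-! ### Algebraic series are holonomic. -/

section Algebraic

variable {σ : Type}

-- An annihilating polynomial of $\beta\ne0$ can be chosen with nonzero constant term; solving for
-- that term inverts $\beta$ up to a denominator.
open Polynomial in
theorem exists_mul_aeval_eq_of_isAlgebraic {A B : Type*} [CommRing A] [CommRing B] [NoZeroDivisors B]
    [Algebra A B] {β : B} (hβ : IsAlgebraic A β) (h0 : β ≠ 0) :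
    ∃ (g : A[X]) (c : A), c ≠ 0 ∧ algebraMap A B c = aeval β g * β := by
  obtain ⟨p, hp0, hp⟩ := hβ.exists_nonzero_coeff_and_aeval_eq_zero (mem_nonZeroDivisors_of_ne_zero h0)
  refine ⟨-p.divX, p.coeff 0, hp0, ?_⟩
  rw [← p.divX_mul_X_add] at hp
  simp only [map_add, map_mul, aeval_X, aeval_C] at hp
  rw [map_neg]
  linear_combination hp

-- Chain rule; `g` is `p` with its coefficients differentiated.
open Polynomial in
theorem pderiv_aeval (i : σ) (p : (MvPolynomial σ ℚ)[X]) (α : MvPowerSeries σ ℚ) :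
    ∃ g : (MvPolynomial σ ℚ)[X],
      pderiv ℚ i (aeval α p) = aeval α g + aeval α (derivative p) * pderiv ℚ i α := by
  induction p using Polynomial.induction_on' with
  | add p q hp hq =>
    obtain ⟨g, hg⟩ := hp
    obtain ⟨g', hg'⟩ := hq
    refine ⟨g + g', ?_⟩
    simp only [map_add, hg, hg']
    ring
  | monomial n a =>
    refine ⟨monomial n (MvPolynomial.pderiv i a), ?_⟩
    simp only [aeval_monomial, derivative_monomial, polyAlgebraMap_eq_coe, Derivation.leibniz,
      MvPowerSeries.pderiv_pow, smul_eq_mul, pderiv_coe, MvPolynomial.coe_mul]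
    have : ((n : MvPolynomial σ ℚ) : MvPowerSeries σ ℚ) = n := by
      rw [← polyAlgebraMap_eq_coe, map_natCast]
    rw [this]
    ring

open Polynomial in
theorem Holonomic.of_isAlgebraic {α : MvPowerSeries σ ℚ}
    (hα : IsAlgebraic (MvPolynomial σ ℚ) α) : Holonomic α := by
  classical
  obtain ⟨p, ⟨hp0, hpα⟩, hmin⟩ : ∃ p : (MvPolynomial σ ℚ)[X], (p ≠ 0 ∧ aeval α p = 0) ∧
      ∀ r : (MvPolynomial σ ℚ)[X], r ≠ 0 → aeval α r = 0 → p.natDegree ≤ r.natDegree := by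
    obtain ⟨p0, h0, h1⟩ := hα
    let S : Set ℕ := {n | ∃ r : (MvPolynomial σ ℚ)[X], r ≠ 0 ∧ aeval α r = 0 ∧ r.natDegree = n}
    have hS : S.Nonempty := ⟨_, p0, h0, h1, rfl⟩
    obtain ⟨r, hr0, hr, hrn⟩ := Nat.sInf_mem hS
    exact ⟨r, ⟨hr0, hr⟩, fun r' h h' => hrn ▸ Nat.sInf_le ⟨r', h, h', rfl⟩⟩
  have hdeg : p.natDegree ≠ 0 := by
    intro h
    rw [natDegree_eq_zero] at h
    obtain ⟨c, rfl⟩ := h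
    rw [aeval_C, polyAlgebraMap_eq_coe, MvPolynomial.coe_eq_zero_iff] at hpα
    exact hp0 (by rw [hpα, C_0])
  -- Separability: in characteristic zero $p'$ is nonzero of smaller degree, so it cannot vanish at
  -- $\alpha$.
  have hder : aeval α (derivative p) ≠ 0 := by
    intro h
    have h1 : derivative p ≠ 0 := fun h => hdeg (derivative_eq_zero.1 h)
    exact absurd (hmin _ h1 h) (not_le.2 (natDegree_derivative_lt hdeg))
  set N := Submodule.span (MvPolynomial σ ℚ)
    (((Finset.range (p.natDegree + 1)).image fun m => α ^ m : Finset _) : Set (MvPowerSeries σ ℚ))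
    with hNdef
  have hpow : ∀ m, m ≤ p.natDegree → α ^ m ∈ N := fun m hm =>
    Submodule.subset_span (by
      simp only [Finset.coe_image, Set.mem_image, Finset.mem_coe, Finset.mem_range]
      exact ⟨m, by omega, rfl⟩)
  -- Higher powers are reduced by $p(\alpha)=0$, with the leading coefficient as denominator.
  have hpow' : ∀ m, α ^ m ∈ saturation N := by
    intro m
    induction m using Nat.strong_induction_on with
    | _ m ih =>
      rcases le_or_gt m p.natDegree with h | h
      · exact le_saturation (hpow m h)
      · refine mem_saturation_of_smul (leadingCoeff_ne_zero.2 hp0) ?_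
        have h1 : p.leadingCoeff • α ^ m =
            -∑ k ∈ Finset.range p.natDegree, p.coeff k • α ^ (k + (m - p.natDegree)) := by
          have h2 : aeval α p * α ^ (m - p.natDegree) = 0 := by rw [hpα, zero_mul]
          rw [aeval_eq_sum_range, Finset.sum_range_succ, add_mul, Finset.sum_mul, smul_mul_assoc,
            ← pow_add, Nat.add_sub_cancel' h.le] at h2
          simp only [smul_mul_assoc, ← pow_add] at h2
          exact eq_neg_of_add_eq_zero_right h2
        rw [h1]
        refine Submodule.neg_mem _ (Submodule.sum_mem _ fun k hk => Submodule.smul_mem _ _ (ih _ ?_))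
        rw [Finset.mem_range] at hk
        omega
  have haeval : ∀ g : (MvPolynomial σ ℚ)[X], aeval α g ∈ saturation N := by
    intro g
    rw [aeval_eq_sum_range]
    exact Submodule.sum_mem _ fun k _ => Submodule.smul_mem _ _ (hpow' k)
  -- Implicit differentiation of $p(\alpha)=0$; the division by $p'(\alpha)$ is replaced by a
  -- polynomial in $p'(\alpha)$ over a denominator.
  have hαd : ∀ i, ∃ (c : MvPolynomial σ ℚ) (g : (MvPolynomial σ ℚ)[X]), c ≠ 0 ∧
      c • pderiv ℚ i α = aeval α g := by
    intro i
    have halg : IsAlgebraic (MvPolynomial σ ℚ) (aeval α (derivative p)) :=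
      Algebra.adjoin_le (S := Subalgebra.algebraicClosure (MvPolynomial σ ℚ) (MvPowerSeries σ ℚ))
        (Set.singleton_subset_iff.2 hα) (aeval_mem_adjoin_singleton _ α)
    obtain ⟨g, c, hc, hgc⟩ := exists_mul_aeval_eq_of_isAlgebraic halg hder
    obtain ⟨r, hr⟩ := pderiv_aeval i p α
    rw [hpα, map_zero] at hr
    refine ⟨c, -(g.comp (derivative p) * r), hc, ?_⟩
    rw [Algebra.smul_def, hgc, map_neg, map_mul, aeval_comp]
    linear_combination (-(aeval (aeval α (derivative p))) g) * hr
  refine ⟨N, Submodule.fg_span (Finset.finite_toSet _), by simpa using hpow 1 (by omega),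
    fun i h hh => ?_⟩
  refine pderiv_mem_span (Submodule.subset_span.trans le_saturation) ?_ hh
  intro x hx
  simp only [Finset.coe_image, Set.mem_image] at hx
  obtain ⟨m, -, rfl⟩ := hx
  obtain ⟨c, g, hc, hg⟩ := hαd i
  refine mem_saturation_of_smul hc ?_
  have : c • pderiv ℚ i (α ^ m) = Polynomial.aeval α ((m : (MvPolynomial σ ℚ)[X]) * Polynomial.X ^ (m - 1) * g) := by
    rw [MvPowerSeries.pderiv_pow, ← mul_smul_comm, hg]
    simp
  rw [this]
  exact haeval _

end Algebraic

/-! ### From spans over rational functions to polynomial modules and back. -/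

section DFiniteBridge

variable {σ : Type}

theorem poly_mem_ratFunField (p : MvPolynomial σ ℚ) :
    algebraMap (MvPowerSeries σ ℚ) (FractionRing (MvPowerSeries σ ℚ)) p ∈ ratFunField σ := by
  induction p using MvPolynomial.induction_on with
  | C a =>
    rw [MvPolynomial.coe_C, MvPowerSeries.c_eq_algebraMap, ← IsScalarTower.algebraMap_apply]
    exact (ratFunField σ).algebraMap_mem a
  | add p q hp hq => rw [MvPolynomial.coe_add, map_add]; exact add_mem hp hq
  | mul_X p i hp =>
    rw [MvPolynomial.coe_mul, map_mul, MvPolynomial.coe_X]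
    exact mul_mem hp (IntermediateField.subset_adjoin _ _ ⟨i, rfl⟩)

/-- A polynomial as an element of the field of rational functions. -/
noncomputable def polyToRatFun (p : MvPolynomial σ ℚ) : ratFunField σ :=
  ⟨_, poly_mem_ratFunField p⟩

theorem polyToRatFun_smul (p : MvPolynomial σ ℚ) (z : FractionRing (MvPowerSeries σ ℚ)) :
    polyToRatFun p • z =
      algebraMap (MvPowerSeries σ ℚ) (FractionRing (MvPowerSeries σ ℚ)) p * z := rfl

theorem polyToRatFun_ne_zero {p : MvPolynomial σ ℚ} (hp : p ≠ 0) : polyToRatFun p ≠ 0 := by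
  intro h
  have h1 := congrArg Subtype.val h
  change algebraMap (MvPowerSeries σ ℚ) (FractionRing (MvPowerSeries σ ℚ)) p = 0 at h1
  rw [map_eq_zero_iff _ (IsFractionRing.injective _ _), MvPolynomial.coe_eq_zero_iff] at h1
  exact hp h1

theorem exists_polyToRatFun_mul_eq (k : ratFunField σ) :
    ∃ q p : MvPolynomial σ ℚ, q ≠ 0 ∧ polyToRatFun q * k = polyToRatFun p := by
  have haev : ∀ r : MvPolynomial σ ℚ, MvPolynomial.aeval (fun i : σ =>
      algebraMap (MvPowerSeries σ ℚ) (FractionRing (MvPowerSeries σ ℚ)) (MvPowerSeries.X i)) r =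
      algebraMap (MvPowerSeries σ ℚ) (FractionRing (MvPowerSeries σ ℚ)) r := by
    intro r
    induction r using MvPolynomial.induction_on with
    | C a =>
      rw [MvPolynomial.coe_C, MvPowerSeries.c_eq_algebraMap, ← IsScalarTower.algebraMap_apply,
        MvPolynomial.aeval_C]
    | add p q hp hq => rw [MvPolynomial.coe_add, map_add, map_add, hp, hq]
    | mul_X p i hp => rw [MvPolynomial.coe_mul, map_mul, map_mul, hp, MvPolynomial.coe_X,
        MvPolynomial.aeval_X]
  obtain ⟨r, s, hrs⟩ := (IntermediateField.mem_adjoin_range_iff ℚ _ _).1 k.2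
  rw [haev, haev] at hrs
  by_cases hs : s = 0
  · refine ⟨1, 0, one_ne_zero, Subtype.ext ?_⟩
    change _ * (k : FractionRing (MvPowerSeries σ ℚ)) = _
    rw [hrs, hs]
    simp [polyToRatFun]
  · refine ⟨s, r, hs, Subtype.ext ?_⟩
    change algebraMap (MvPowerSeries σ ℚ) _ (s : MvPowerSeries σ ℚ) *
      (k : FractionRing (MvPowerSeries σ ℚ)) = algebraMap _ _ (r : MvPowerSeries σ ℚ)
    rw [hrs, mul_div_cancel₀]
    rw [Ne, map_eq_zero_iff _ (IsFractionRing.injective _ _), MvPolynomial.coe_eq_zero_iff]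
    exact hs

/-- Clearing denominators translates linear algebra over the rational functions into saturations. -/
theorem mem_saturation_span_iff {s : Set (MvPowerSeries σ ℚ)} {h : MvPowerSeries σ ℚ} :
    h ∈ saturation (Submodule.span (MvPolynomial σ ℚ) s) ↔
      algebraMap _ (FractionRing (MvPowerSeries σ ℚ)) h ∈ Submodule.span (ratFunField σ)
        (algebraMap _ (FractionRing (MvPowerSeries σ ℚ)) '' s) := by
  constructor
  · rintro ⟨q, hq, hm⟩
    have key : ∀ g ∈ Submodule.span (MvPolynomial σ ℚ) s,
        algebraMap _ (FractionRing (MvPowerSeries σ ℚ)) g ∈ Submodule.span (ratFunField σ)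
          (algebraMap _ (FractionRing (MvPowerSeries σ ℚ)) '' s) := by
      intro g hg
      induction hg using Submodule.span_induction with
      | mem x hx => exact Submodule.subset_span ⟨x, hx, rfl⟩
      | zero => simp
      | add x y _ _ hx hy => rw [map_add]; exact Submodule.add_mem _ hx hy
      | smul a x hx ih =>
        rw [poly_smul_eq, map_mul, ← polyToRatFun_smul]
        exact Submodule.smul_mem _ _ ih
    have h1 := key _ hm
    rw [poly_smul_eq, map_mul, ← polyToRatFun_smul] at h1
    exact (Submodule.smul_mem_iff _ (polyToRatFun_ne_zero hq)).1 h1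
  · intro hm
    have key : ∀ z ∈ Submodule.span (ratFunField σ)
        (algebraMap _ (FractionRing (MvPowerSeries σ ℚ)) '' s),
        ∃ q : MvPolynomial σ ℚ, q ≠ 0 ∧ ∃ g ∈ Submodule.span (MvPolynomial σ ℚ) s,
          polyToRatFun q • z = algebraMap _ (FractionRing (MvPowerSeries σ ℚ)) g := by
      intro z hz
      induction hz using Submodule.span_induction with
      | mem x hx =>
        obtain ⟨y, hy, rfl⟩ := hx
        exact ⟨1, one_ne_zero, y, Submodule.subset_span hy, by simp [polyToRatFun_smul]⟩
      | zero => exact ⟨1, one_ne_zero, 0, Submodule.zero_mem _, by simp⟩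
      | add x y _ _ hx hy =>
        obtain ⟨p, hp, g, hg, hpg⟩ := hx
        obtain ⟨q, hq, f, hf, hqf⟩ := hy
        refine ⟨p * q, mul_ne_zero hp hq, q • g + p • f, Submodule.add_mem _
          (Submodule.smul_mem _ _ hg) (Submodule.smul_mem _ _ hf), ?_⟩
        rw [polyToRatFun_smul] at hpg hqf ⊢
        rw [poly_smul_eq, poly_smul_eq, map_add, map_mul, map_mul, ← hpg, ← hqf,
          MvPolynomial.coe_mul, map_mul]
        ring
      | smul a x hx ih =>
        obtain ⟨p, hp, g, hg, hpg⟩ := ih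
        obtain ⟨q, r, hq, hqr⟩ := exists_polyToRatFun_mul_eq a
        refine ⟨q * p, mul_ne_zero hq hp, r • g, Submodule.smul_mem _ _ hg, ?_⟩
        rw [poly_smul_eq, map_mul, ← hpg, ← polyToRatFun_smul, ← hqr, mul_smul, smul_comm a]
        simp only [polyToRatFun_smul, MvPolynomial.coe_mul, map_mul, mul_assoc]
    obtain ⟨q, hq, g, hg, hqg⟩ := key _ hm
    refine ⟨q, hq, ?_⟩
    rw [polyToRatFun_smul, ← map_mul] at hqg
    rw [poly_smul_eq, IsFractionRing.injective _ _ hqg]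
    exact hg

/-- The spans of the first derivatives form an ascending chain in a finite-dimensional space, so
they stabilise. -/
theorem DFiniteWrt.exists_iterate_mem {i : σ} {F : MvPowerSeries σ ℚ} (hF : DFiniteWrt i F) :
    ∃ r : ℕ, (pderiv ℚ i)^[r + 1] F ∈ saturation (Submodule.span (MvPolynomial σ ℚ)
      ((fun m => (pderiv ℚ i)^[m] F) '' Set.Iic r)) := by
  let φ := algebraMap (MvPowerSeries σ ℚ) (FractionRing (MvPowerSeries σ ℚ))
  let v : ℕ → FractionRing (MvPowerSeries σ ℚ) := fun m => φ ((pderiv ℚ i)^[m] F)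
  let W := Submodule.span (ratFunField σ) (Set.range v)
  have hW : FiniteDimensional (ratFunField σ) W := hF
  let Y : ℕ →o Submodule (ratFunField σ) W :=
    ⟨fun n => (Submodule.span (ratFunField σ) (v '' Set.Iic n)).comap W.subtype,
      fun a b hab => Submodule.comap_mono (Submodule.span_mono (Set.image_mono
        (Set.Iic_subset_Iic.2 hab)))⟩
  obtain ⟨r, hr⟩ := (monotone_stabilizes_iff_noetherian (R := ratFunField σ) (M := W)).2
    inferInstance Y
  refine ⟨r, mem_saturation_span_iff.2 ?_⟩
  rw [Set.image_image]
  have h1 := hr (r + 1) (Nat.le_succ r)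
  have h2 : (⟨v (r + 1), Submodule.subset_span ⟨_, rfl⟩⟩ : W) ∈ Y (r + 1) :=
    Submodule.subset_span ⟨r + 1, Set.mem_Iic.2 le_rfl, rfl⟩
  rw [← h1] at h2
  exact h2

/-- Once zero top coefficients are dropped, the top derivative depends on the lower ones, whose span
up to denominators is therefore stable under $\partial_i$. -/
theorem DFiniteWrt.of_relation {i : σ} {F : MvPowerSeries σ ℚ} {n : ℕ}
    (p : ℕ → MvPolynomial σ ℚ) (hp : ∃ f ∈ Finset.range n, p f ≠ 0)
    (hrel : ∑ f ∈ Finset.range n, p f • (pderiv ℚ i)^[f] F = 0) : DFiniteWrt i F := by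
  induction n with
  | zero => simp at hp
  | succ r ih =>
    by_cases hr : p r = 0
    · refine ih ?_ (by simpa [Finset.sum_range_succ, hr] using hrel)
      obtain ⟨f, hf, hpf⟩ := hp
      refine ⟨f, Finset.mem_range.2 (lt_of_le_of_ne (Finset.mem_range_succ_iff.1 hf) ?_), hpf⟩
      rintro rfl
      exact hpf hr
    · set s : Set (MvPowerSeries σ ℚ) := (fun m => (pderiv ℚ i)^[m] F) '' Set.Iio r with hs
      have htop : (pderiv ℚ i)^[r] F ∈ saturation (Submodule.span (MvPolynomial σ ℚ) s) := by
        refine ⟨p r, hr, ?_⟩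
        rw [Finset.sum_range_succ] at hrel
        rw [eq_neg_of_add_eq_zero_right hrel]
        refine Submodule.neg_mem _ (Submodule.sum_mem _ fun f hf => Submodule.smul_mem _ _
          (Submodule.subset_span ⟨f, Finset.mem_range.1 hf, rfl⟩))
      have hclosed : ∀ h ∈ saturation (Submodule.span (MvPolynomial σ ℚ) s),
          pderiv ℚ i h ∈ saturation (Submodule.span (MvPolynomial σ ℚ) s) := by
        refine fun h => pderiv_mem_saturation le_saturation fun g hg =>
          pderiv_mem_span (Submodule.subset_span.trans le_saturation) ?_ hg
        rintro _ ⟨m, hm, rfl⟩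
        simp only [← Function.iterate_succ_apply']
        rcases Nat.lt_or_ge (m + 1) r with h | h
        · exact le_saturation (Submodule.subset_span ⟨m + 1, h, rfl⟩)
        · rw [show m.succ = r from le_antisymm hm h]
          exact htop
      have hall : ∀ m, (pderiv ℚ i)^[m] F ∈ saturation (Submodule.span (MvPolynomial σ ℚ) s) := by
        intro m
        induction m with
        | zero =>
          rcases Nat.eq_zero_or_pos r with h | h
          · rw [h] at htop; exact htop
          · exact le_saturation (Submodule.subset_span ⟨0, h, rfl⟩)
        | succ m ihm => rw [Function.iterate_succ_apply']; exact hclosed _ ihm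
      have hfin : FiniteDimensional (ratFunField σ) (Submodule.span (ratFunField σ)
          (algebraMap _ (FractionRing (MvPowerSeries σ ℚ)) '' s)) :=
        FiniteDimensional.span_of_finite _ (((Set.finite_Iio r).image _).image _)
      have hle : Submodule.span (ratFunField σ) (Set.range fun m : ℕ =>
          algebraMap (MvPowerSeries σ ℚ) (FractionRing (MvPowerSeries σ ℚ))
            ((pderiv ℚ i)^[m] F)) ≤ Submodule.span (ratFunField σ)
          (algebraMap _ (FractionRing (MvPowerSeries σ ℚ)) '' s) := by
        refine Submodule.span_le.2 ?_
        rintro _ ⟨m, rfl⟩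
        exact mem_saturation_span_iff.1 (hall m)
      exact Submodule.finiteDimensional_of_le hle

end DFiniteBridge

/-! ### D-finite series in finitely many variables are holonomic. -/

section MixedDerivatives

variable {σ : Type}

instance pderivLeftCommutative :
    LeftCommutative fun (i : σ) (h : MvPowerSeries σ ℚ) => pderiv ℚ i h :=
  ⟨fun i j h => pderiv_comm i j h⟩

/-- The iterated derivative of `F` with respect to a multiset of variables. -/
noncomputable def mixedDeriv (F : MvPowerSeries σ ℚ) (w : Multiset σ) : MvPowerSeries σ ℚ :=
  w.foldr (fun i h => pderiv ℚ i h) F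

theorem mixedDeriv_cons (F : MvPowerSeries σ ℚ) (i : σ) (w : Multiset σ) :
    mixedDeriv F (i ::ₘ w) = pderiv ℚ i (mixedDeriv F w) :=
  Multiset.foldr_cons _ _ _ _

theorem mixedDeriv_add (F : MvPowerSeries σ ℚ) (w w' : Multiset σ) :
    mixedDeriv F (w + w') = mixedDeriv (mixedDeriv F w') w :=
  Multiset.foldr_add _ _ _ _

theorem mixedDeriv_replicate (F : MvPowerSeries σ ℚ) (i : σ) (n : ℕ) :
    mixedDeriv F (Multiset.replicate n i) = (pderiv ℚ i)^[n] F := by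
  induction n with
  | zero => simp [mixedDeriv]
  | succ n ih => rw [Multiset.replicate_succ, mixedDeriv_cons, ih, Function.iterate_succ_apply']

/-- The module generated by the derivatives of order less than `n`. -/
noncomputable def derivFiltration (F : MvPowerSeries σ ℚ) (n : ℕ) :
    Submodule (MvPolynomial σ ℚ) (MvPowerSeries σ ℚ) :=
  Submodule.span _ (mixedDeriv F '' {w | w.card < n})

theorem mixedDeriv_mem_derivFiltration (F : MvPowerSeries σ ℚ) {w : Multiset σ} {n : ℕ}
    (h : w.card < n) : mixedDeriv F w ∈ derivFiltration F n :=
  Submodule.subset_span ⟨w, h, rfl⟩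

theorem derivFiltration_mono (F : MvPowerSeries σ ℚ) {m n : ℕ} (h : m ≤ n) :
    derivFiltration F m ≤ derivFiltration F n :=
  Submodule.span_mono (Set.image_mono fun _ hw => lt_of_lt_of_le hw h)

theorem mixedDeriv_mem_saturation_derivFiltration {F h : MvPowerSeries σ ℚ} {n : ℕ}
    (hh : h ∈ saturation (derivFiltration F n)) (w : Multiset σ) :
    mixedDeriv h w ∈ saturation (derivFiltration F (n + w.card)) := by
  induction w using Multiset.induction_on with
  | empty => simpa [mixedDeriv] using hh
  | cons i w ih =>
    rw [mixedDeriv_cons, Multiset.card_cons]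
    refine pderiv_mem_saturation ((derivFiltration_mono F (by omega)).trans le_saturation)
      (fun g hg => ?_) ih
    refine pderiv_mem_span (Set.Subset.trans ?_ le_saturation) ?_ hg
    · rintro _ ⟨w', hw', rfl⟩
      exact mixedDeriv_mem_derivFiltration F (by simp only [Set.mem_ofPred_eq] at hw'; omega)
    · rintro _ ⟨w', hw', rfl⟩
      rw [← mixedDeriv_cons]
      refine le_saturation (mixedDeriv_mem_derivFiltration F ?_)
      simp only [Set.mem_ofPred_eq] at hw'
      rw [Multiset.card_cons]
      omega

/-- A mixed derivative of order above $r_i$ in some direction $i$ reduces, by the relation in that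
direction, to derivatives of smaller total order. By induction the finitely many mixed derivatives
of order at most $r_i$ in each direction generate all of them up to denominators. -/
theorem DFinite.holonomic [Finite σ] {F : MvPowerSeries σ ℚ} (hF : DFinite F) : Holonomic F := by
  classical
  cases nonempty_fintype σ
  choose r hr using fun i => (hF i).exists_iterate_mem
  set M : Multiset σ := ∑ i, Multiset.replicate (r i) i with hM
  have hcount : ∀ i, M.count i = r i := by
    intro i
    simp [hM, Multiset.count_sum', Multiset.count_replicate]
  set N := Submodule.span (MvPolynomial σ ℚ) (mixedDeriv F '' Set.Iic M) with hN
  have hY : ∀ n, derivFiltration F n ≤ saturation N := by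
    intro n
    induction n with
    | zero => simp [derivFiltration]
    | succ n ih =>
      refine Submodule.span_le.2 ?_
      rintro _ ⟨w, hw, rfl⟩
      by_cases hwM : w ≤ M
      · exact le_saturation (Submodule.subset_span ⟨w, hwM, rfl⟩)
      · rw [Multiset.le_iff_count] at hwM
        push Not at hwM
        obtain ⟨i, hi⟩ := hwM
        rw [hcount] at hi
        obtain ⟨w', rfl⟩ := Multiset.le_iff_exists_add.1 (Multiset.le_count_iff_replicate_le.1 hi)
        rw [add_comm, mixedDeriv_add, mixedDeriv_replicate]
        have h1 : (pderiv ℚ i)^[r i + 1] F ∈ saturation (derivFiltration F (r i + 1)) := by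
          refine saturation_mono (Submodule.span_le.2 ?_) (hr i)
          rintro _ ⟨m, hm, rfl⟩
          simp only [← mixedDeriv_replicate]
          refine mixedDeriv_mem_derivFiltration F ?_
          rw [Multiset.card_replicate]
          exact Nat.lt_succ_of_le hm
        refine saturation_le ih (saturation_mono (derivFiltration_mono F ?_)
          (mixedDeriv_mem_saturation_derivFiltration h1 w'))
        simp only [Set.mem_ofPred_eq, Multiset.card_add, Multiset.card_replicate] at hw
        omega
  refine ⟨N, Submodule.fg_span ((Set.finite_Iic M).image _),
    Submodule.subset_span ⟨0, Multiset.zero_le _, rfl⟩, fun i h hh => ?_⟩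
  refine pderiv_mem_span (Submodule.subset_span.trans le_saturation) ?_ hh
  rintro _ ⟨w, -, rfl⟩
  rw [← mixedDeriv_cons]
  exact hY _ (mixedDeriv_mem_derivFiltration F (Nat.lt_succ_self _))

end MixedDerivatives

/-! ### Finite-dimensional spaces of bounded degree. -/

section BoxSpan

variable {σ : Type} [Fintype σ] {r : ℕ}

/-- The `ℚ`-span of the products of the `b k` with the monomials having all exponents at
most `M`. -/
noncomputable def boxSpan (b : Fin r → MvPowerSeries σ ℚ) (M : ℕ) :
    Submodule ℚ (MvPowerSeries σ ℚ) :=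
  Submodule.span ℚ (Set.range fun p : (σ → Fin (M + 1)) × Fin r =>
    monomial (Finsupp.equivFunOnFinite.symm fun j => (p.1 j : ℕ)) 1 * b p.2)

variable {b : Fin r → MvPowerSeries σ ℚ}

instance (M : ℕ) : FiniteDimensional ℚ (boxSpan b M) :=
  FiniteDimensional.span_of_finite _ (Set.finite_range _)

theorem finrank_boxSpan_le (M : ℕ) :
    Module.finrank ℚ (boxSpan b M) ≤ (M + 1) ^ Fintype.card σ * r := by
  classical
  refine (finrank_range_le_card _).trans ?_
  simp

theorem monomial_mul_mem_boxSpan {M : ℕ} {α : σ →₀ ℕ} (hα : ∀ j, α j ≤ M) (k : Fin r) :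
    monomial α 1 * b k ∈ boxSpan b M := by
  refine Submodule.subset_span ⟨(fun j => ⟨α j, Nat.lt_succ_of_le (hα j)⟩, k), ?_⟩
  simp only
  congr 2
  ext j
  simp

theorem boxSpan_le {M : ℕ} {S : Submodule ℚ (MvPowerSeries σ ℚ)}
    (h : ∀ α : σ →₀ ℕ, (∀ j, α j ≤ M) → ∀ k, monomial α 1 * b k ∈ S) : boxSpan b M ≤ S := by
  refine Submodule.span_le.2 ?_
  rintro _ ⟨p, rfl⟩
  refine h _ (fun j => ?_) _
  simpa using Nat.lt_succ_iff.1 (p.1 j).2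

theorem boxSpan_mono {M M' : ℕ} (h : M ≤ M') : boxSpan b M ≤ boxSpan b M' :=
  boxSpan_le fun _ hα k => monomial_mul_mem_boxSpan (fun j => (hα j).trans h) k

theorem monomial_mul_mem_boxSpan_add {M d : ℕ} {β : σ →₀ ℕ} (hβ : ∀ j, β j ≤ d)
    {h : MvPowerSeries σ ℚ} (hh : h ∈ boxSpan b M) : monomial β 1 * h ∈ boxSpan b (M + d) := by
  have : boxSpan b M ≤ (boxSpan b (M + d)).comap (LinearMap.mulLeft ℚ (monomial β (1 : ℚ))) := by
    refine boxSpan_le fun α hα k => ?_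
    rw [Submodule.mem_comap, LinearMap.mulLeft_apply, ← mul_assoc, monomial_mul_monomial, one_mul]
    refine monomial_mul_mem_boxSpan (fun j => ?_) k
    rw [Finsupp.add_apply, add_comm]
    exact add_le_add (hα j) (hβ j)
  exact this hh

theorem exists_poly_mul_mem_boxSpan (p : MvPolynomial σ ℚ) :
    ∃ d, ∀ M, ∀ h ∈ boxSpan b M, (p : MvPowerSeries σ ℚ) * h ∈ boxSpan b (M + d) := by
  induction p using MvPolynomial.induction_on' with
  | monomial u a =>
    refine ⟨∑ j, u j, fun M h hh => ?_⟩
    have h1 := Submodule.smul_mem _ a (monomial_mul_mem_boxSpan_add (b := b) (M := M)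
      (fun j => Finset.single_le_sum (f := u) (fun _ _ => Nat.zero_le _) (Finset.mem_univ j)) hh)
    rwa [← smul_mul_assoc, ← map_smul, smul_eq_mul, mul_one, ← MvPolynomial.coe_monomial] at h1
  | add p q hp hq =>
    obtain ⟨d, hd⟩ := hp
    obtain ⟨d', hd'⟩ := hq
    refine ⟨d + d', fun M h hh => ?_⟩
    rw [MvPolynomial.coe_add, add_mul]
    exact Submodule.add_mem _ (boxSpan_mono (by omega) (hd M h hh))
      (boxSpan_mono (by omega) (hd' M h hh))

theorem exists_mem_boxSpan {h : MvPowerSeries σ ℚ}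
    (hh : h ∈ Submodule.span (MvPolynomial σ ℚ) (Set.range b)) : ∃ d, h ∈ boxSpan b d := by
  induction hh using Submodule.span_induction with
  | mem x hx =>
    obtain ⟨k, rfl⟩ := hx
    refine ⟨0, ?_⟩
    have := monomial_mul_mem_boxSpan (b := b) (M := 0) (α := 0) (fun _ => le_rfl) k
    rwa [monomial_zero_one, one_mul] at this
  | zero => exact ⟨0, Submodule.zero_mem _⟩
  | add x y _ _ hx hy =>
    obtain ⟨d, hd⟩ := hx
    obtain ⟨d', hd'⟩ := hy
    exact ⟨d + d', Submodule.add_mem _ (boxSpan_mono (by omega) hd)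
      (boxSpan_mono (by omega) hd')⟩
  | smul a x _ ih =>
    obtain ⟨d, hd⟩ := ih
    obtain ⟨d', hd'⟩ := exists_poly_mul_mem_boxSpan (b := b) a
    exact ⟨_, by rw [poly_smul_eq]; exact hd' _ _ hd⟩

theorem pderiv_monomial_one {σ : Type} (i : σ) (α : σ →₀ ℕ) :
    pderiv ℚ i (monomial α 1) = (α i : ℚ) • monomial (α - Finsupp.single i 1) 1 := by
  rw [← MvPolynomial.coe_monomial, pderiv_coe, MvPolynomial.pderiv_monomial, one_mul,
    MvPolynomial.coe_monomial, ← map_smul, smul_eq_mul, mul_one]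

theorem exists_mul_pderiv_mem_boxSpan {q : MvPolynomial σ ℚ} {i : σ}
    (hq : ∀ k, (q : MvPowerSeries σ ℚ) * pderiv ℚ i (b k) ∈
      Submodule.span (MvPolynomial σ ℚ) (Set.range b)) :
    ∃ d, ∀ M, ∀ h ∈ boxSpan b M,
      (q : MvPowerSeries σ ℚ) * pderiv ℚ i h ∈ boxSpan b (M + d) := by
  obtain ⟨d, hd⟩ := exists_poly_mul_mem_boxSpan (b := b) q
  choose d' hd' using fun k => exists_mem_boxSpan (hq k)
  refine ⟨d + ∑ k, d' k, fun M h hh => ?_⟩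
  have : boxSpan b M ≤ (boxSpan b (M + (d + ∑ k, d' k))).comap
      ((LinearMap.mulLeft ℚ (q : MvPowerSeries σ ℚ)).comp (pderiv ℚ i).toLinearMap) := by
    refine boxSpan_le fun α hα k => ?_
    rw [Submodule.mem_comap, LinearMap.comp_apply, LinearMap.mulLeft_apply,
      Derivation.coeFn_coe, Derivation.leibniz, pderiv_monomial_one,
      mul_add, smul_eq_mul, smul_eq_mul]
    refine Submodule.add_mem _ ?_ ?_
    · rw [mul_left_comm]
      refine boxSpan_mono ?_ (monomial_mul_mem_boxSpan_add hα (hd' k))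
      have := Finset.single_le_sum (f := d') (fun _ _ => Nat.zero_le _) (Finset.mem_univ k)
      omega
    · rw [mul_smul_comm, mul_smul_comm]
      refine Submodule.smul_mem _ _ (boxSpan_mono ?_ (hd M _ ?_))
      · omega
      · rw [mul_comm]
        exact monomial_mul_mem_boxSpan (fun j => (Nat.sub_le _ _).trans (hα j)) k
  exact this hh

end BoxSpan

/-! ### Degree growth under multiplication and differentiation. -/

section PoleFiltration

variable {σ : Type}

/-- A filtration of series by the size of the exponents of numerator and denominator, in which
multiplication by a variable and differentiation raise the degree by one. -/
structure PoleFiltration (q : MvPolynomial σ ℚ) (c : ℕ)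
    (E : ℕ → Submodule ℚ (MvPowerSeries σ ℚ)) : Prop where
  mono : Monotone E
  mul_denom : ∀ M, ∀ h ∈ E M, (q : MvPowerSeries σ ℚ) * h ∈ E (M + c)
  mul_pderiv : ∀ i M, ∀ h ∈ E M, (q : MvPowerSeries σ ℚ) * pderiv ℚ i h ∈ E (M + c)
  pderiv_mul : ∀ i M, ∀ h ∈ E M,
    (MvPolynomial.pderiv i q : MvPowerSeries σ ℚ) * h ∈ E (M + c)
  mul_X : ∀ i M, ∀ h ∈ E M, (q : MvPowerSeries σ ℚ) * (X i * h) ∈ E (M + c)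

theorem exists_poleFiltration [Fintype σ] {r : ℕ} {b : Fin r → MvPowerSeries σ ℚ} {q : MvPolynomial σ ℚ}
    (hq : ∀ i k, (q : MvPowerSeries σ ℚ) * pderiv ℚ i (b k) ∈
      Submodule.span (MvPolynomial σ ℚ) (Set.range b)) :
    ∃ c, PoleFiltration q c (boxSpan b) := by
  obtain ⟨c1, h1⟩ := exists_poly_mul_mem_boxSpan (b := b) q
  choose c2 h2 using fun i => exists_mul_pderiv_mem_boxSpan (hq i)
  choose c3 h3 using fun i => exists_poly_mul_mem_boxSpan (b := b) (MvPolynomial.pderiv i q)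
  choose c4 h4 using fun i => exists_poly_mul_mem_boxSpan (b := b) (q * MvPolynomial.X i)
  have hle : ∀ (c : σ → ℕ) i, c i ≤ ∑ j, c j := fun c i =>
    Finset.single_le_sum (f := c) (fun _ _ => Nat.zero_le _) (Finset.mem_univ i)
  refine ⟨c1 + ∑ i, c2 i + ∑ i, c3 i + ∑ i, c4 i, fun _ _ => boxSpan_mono,
    fun M h hh => boxSpan_mono (by omega) (h1 M h hh),
    fun i M h hh => boxSpan_mono ?_ (h2 i M h hh),
    fun i M h hh => boxSpan_mono ?_ (h3 i M h hh),
    fun i M h hh => boxSpan_mono (M := M + c4 i) ?_ ?_⟩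
  · have := hle c2 i; omega
  · have := hle c3 i; omega
  · have := hle c4 i; omega
  · rw [← mul_assoc, ← MvPolynomial.coe_X, ← MvPolynomial.coe_mul]
    exact h4 i M h hh

variable {q : MvPolynomial σ ℚ} {c : ℕ} {E : ℕ → Submodule ℚ (MvPowerSeries σ ℚ)} {d : ℕ}

/-- The series `h` with `q ^ n * h ∈ E (d + c * n)`. -/
noncomputable def poleLevel (q : MvPolynomial σ ℚ) (c : ℕ)
    (E : ℕ → Submodule ℚ (MvPowerSeries σ ℚ)) (d n : ℕ) : Submodule ℚ (MvPowerSeries σ ℚ) :=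
  (E (d + c * n)).comap (LinearMap.mulLeft ℚ ((q : MvPowerSeries σ ℚ) ^ n))

theorem mem_poleLevel {n : ℕ} {h : MvPowerSeries σ ℚ} :
    h ∈ poleLevel q c E d n ↔ (q : MvPowerSeries σ ℚ) ^ n * h ∈ E (d + c * n) := Iff.rfl

namespace PoleFiltration

theorem poleLevel_succ (hE : PoleFiltration q c E) {n : ℕ} :
    poleLevel q c E d n ≤ poleLevel q c E d (n + 1) := by
  intro h hh
  rw [mem_poleLevel] at hh ⊢
  have h1 := hE.mul_denom _ _ hh
  rwa [← mul_assoc, ← pow_succ', add_assoc, ← mul_add_one] at h1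

theorem poleLevel_mono (hE : PoleFiltration q c E) {m n : ℕ} (hmn : m ≤ n) :
    poleLevel q c E d m ≤ poleLevel q c E d n := by
  induction n, hmn using Nat.le_induction with
  | base => exact le_rfl
  | succ k _ ih => exact ih.trans hE.poleLevel_succ

theorem X_mul_mem (hE : PoleFiltration q c E) {n : ℕ} {h : MvPowerSeries σ ℚ}
    (hh : h ∈ poleLevel q c E d n) (i : σ) : X i * h ∈ poleLevel q c E d (n + 1) := by
  rw [mem_poleLevel] at hh ⊢
  have h1 := hE.mul_X i _ _ hh
  rw [add_assoc, ← mul_add_one] at h1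
  have h2 : (q : MvPowerSeries σ ℚ) * (X i * ((q : MvPowerSeries σ ℚ) ^ n * h)) =
      (q : MvPowerSeries σ ℚ) ^ (n + 1) * (X i * h) := by ring
  rwa [h2] at h1

/-- From $q^{n+1}\partial h=q\,\partial(q^nh)-n(\partial q)q^nh$: a derivative costs one factor $q$,
and the degree bound grows only linearly in $n$. -/
theorem pderiv_mem (hE : PoleFiltration q c E) {n : ℕ} {h : MvPowerSeries σ ℚ}
    (hh : h ∈ poleLevel q c E d n) (i : σ) : pderiv ℚ i h ∈ poleLevel q c E d (n + 1) := by
  rw [mem_poleLevel] at hh ⊢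
  have h1 := hE.mul_pderiv i _ _ hh
  have h2 := Submodule.smul_mem _ (n : ℚ) (hE.pderiv_mul i _ _ hh)
  have h3 := Submodule.sub_mem _ h1 h2
  rw [add_assoc, ← mul_add_one] at h3
  have h4 : (q : MvPowerSeries σ ℚ) * pderiv ℚ i ((q : MvPowerSeries σ ℚ) ^ n * h) -
      (n : ℚ) • ((MvPolynomial.pderiv i q : MvPowerSeries σ ℚ) * ((q : MvPowerSeries σ ℚ) ^ n * h))
      = (q : MvPowerSeries σ ℚ) ^ (n + 1) * pderiv ℚ i h := by
    rw [Derivation.leibniz, MvPowerSeries.pderiv_pow, pderiv_coe,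
      smul_eq_mul, smul_eq_mul, smul_eq_C_mul, map_natCast]
    cases n with
    | zero => simp
    | succ n => simp only [Nat.add_sub_cancel]; ring
  rwa [h4] at h3

theorem monomial_mul_mem (hE : PoleFiltration q c E) {n : ℕ} {h : MvPowerSeries σ ℚ}
    (hh : h ∈ poleLevel q c E d n) (β : σ →₀ ℕ) :
    monomial β 1 * h ∈ poleLevel q c E d (n + β.degree) := by
  induction β using Finsupp.induction_linear generalizing n h with
  | zero => simpa using hh
  | add f g hf hg =>
    have h1 := hf (hg hh)
    rwa [← mul_assoc, monomial_mul_monomial, one_mul, add_assoc, add_comm g.degree,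
      ← map_add] at h1
  | single j k =>
    rw [← X_pow_eq, Finsupp.degree_single]
    induction k with
    | zero => simpa using hh
    | succ k ih =>
      rw [pow_succ', mul_assoc]
      exact hE.X_mul_mem ih j

end PoleFiltration

end PoleFiltration

/-! ### Operators acting diagonally on monomials. -/

section EulerOperators

variable {σ : Type}

theorem coeff_X_mul_pderiv (i : σ) (h : MvPowerSeries σ ℚ) (n : σ →₀ ℕ) :
    coeff n (X i * pderiv ℚ i h) = n i * coeff n h := by
  classical
  rw [X_def, coeff_monomial_mul]
  split_ifs with hle
  · rw [one_mul, coeff_pderiv, tsub_add_cancel_of_le hle, mul_comm]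
    congr 1
    rw [Finsupp.tsub_apply, Finsupp.single_eq_same]
    have : 1 ≤ n i := by simpa using hle i
    push_cast [this]
    ring
  · have : n i = 0 := by
      by_contra h0
      exact hle (Finsupp.single_le_iff.2 (Nat.one_le_iff_ne_zero.2 h0))
    simp [this]

/-- The factor is a falling factorial of the exponent of $x_i$ alone, which is why
$x_i^f\partial_i^f$ commutes with taking the diagonal. -/
theorem coeff_X_pow_mul_iterate_pderiv (i : σ) (h : MvPowerSeries σ ℚ) (f : ℕ) (n : σ →₀ ℕ) :
    coeff n (X i ^ f * (pderiv ℚ i)^[f] h) = (∏ j ∈ Finset.range f, ((n i : ℚ) - j)) * coeff n h := by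
  induction f with
  | zero => simp
  | succ f ih =>
    have h1 : X i ^ (f + 1) * (pderiv ℚ i)^[f + 1] h =
        X i * pderiv ℚ i (X i ^ f * (pderiv ℚ i)^[f] h) -
          (f : ℚ) • (X i ^ f * (pderiv ℚ i)^[f] h) := by
      rw [Derivation.leibniz, MvPowerSeries.pderiv_pow, pderiv_X_self, Function.iterate_succ_apply',
        smul_eq_mul, smul_eq_mul, smul_eq_C_mul, map_natCast]
      cases f with
      | zero => simp
      | succ f => simp only [Nat.add_sub_cancel]; ring
    rw [h1, map_sub, coeff_X_mul_pderiv, map_smul, ih, Finset.prod_range_succ, smul_eq_mul]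
    ring

end EulerOperators

/-! ### Diagonals of holonomic series are D-finite. -/

section Diagonal

variable {ι : Type}

/-- The exponent of the monomial `x^m` with an additional variable raised to the power `m τ`. -/
noncomputable def diagExp (τ : ι) (m : ι →₀ ℕ) : Option ι →₀ ℕ :=
  m.mapDomain some + Finsupp.single none (m τ)

theorem diagExp_some (τ : ι) (m : ι →₀ ℕ) (j : ι) : diagExp τ m (some j) = m j := by
  simp [diagExp, Finsupp.mapDomain_apply (Option.some_injective ι)]

theorem diagExp_none (τ : ι) (m : ι →₀ ℕ) : diagExp τ m none = m τ := by
  simp [diagExp, Finsupp.mapDomain_of_notMem_range]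

theorem degree_diagExp_le (τ : ι) (m : ι →₀ ℕ) : (diagExp τ m).degree ≤ 2 * m.degree := by
  rw [diagExp, map_add, Finsupp.degree_single, two_mul]
  refine add_le_add ?_ (Finsupp.le_degree τ m)
  rw [Finsupp.degree_mapDomain]

/-- The diagonal of `G` with respect to the variables `none` and `some τ`. -/
noncomputable def diagonal (τ : ι) (G : MvPowerSeries (Option ι) ℚ) : MvPowerSeries ι ℚ :=
  fun m => coeff (diagExp τ m) G

theorem coeff_diagonal (τ : ι) (G : MvPowerSeries (Option ι) ℚ) (m : ι →₀ ℕ) :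
    coeff m (diagonal τ G) = coeff (diagExp τ m) G := rfl

theorem diagonal_X_pow_mul_iterate_pderiv (τ i : ι) (G : MvPowerSeries (Option ι) ℚ) (f : ℕ) :
    diagonal τ (X (some i) ^ f * (pderiv ℚ (some i))^[f] G) =
      X i ^ f * (pderiv ℚ i)^[f] (diagonal τ G) := by
  ext m
  rw [coeff_diagonal, coeff_X_pow_mul_iterate_pderiv, coeff_X_pow_mul_iterate_pderiv,
    coeff_diagonal, diagExp_some]

/-- The operator `(D - e) ⋯ (D - 2) (D - 1)` for `D = s ∂ₛ - τ ∂_τ`, where `s` is the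
variable `none`. -/
noncomputable def antidiagOp (τ : ι) (h : MvPowerSeries (Option ι) ℚ) :
    ℕ → MvPowerSeries (Option ι) ℚ
  | 0 => h
  | e + 1 => X none * pderiv ℚ none (antidiagOp τ h e) -
      X (some τ) * pderiv ℚ (some τ) (antidiagOp τ h e) - ((e : ℚ) + 1) • antidiagOp τ h e

/-- The factor vanishes exactly when the exponent of $s$ exceeds that of $\tau$ by one of
$1,\dots,e$; on the diagonal it is $(-1)^e e!\neq0$. -/
theorem coeff_antidiagOp (τ : ι) (h : MvPowerSeries (Option ι) ℚ) (e : ℕ) (n : Option ι →₀ ℕ) :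
    coeff n (antidiagOp τ h e) =
      (∏ j ∈ Finset.range e, ((n none : ℚ) - n (some τ) - (j + 1))) * coeff n h := by
  induction e with
  | zero => simp [antidiagOp]
  | succ e ih =>
    rw [antidiagOp, map_sub, map_sub, map_smul, coeff_X_mul_pderiv, coeff_X_mul_pderiv, ih,
      Finset.prod_range_succ, smul_eq_mul]
    ring

theorem diagExp_add_single_le_iff (τ : ι) {a m : ι →₀ ℕ} {x y : ℕ} (hxy : x ≤ y) :
    diagExp τ a + Finsupp.single none x ≤ diagExp τ m + Finsupp.single none y ↔ a ≤ m := by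
  constructor
  · intro h j
    simpa [diagExp_some] using h (some j)
  · rintro h (_ | j)
    · simpa [diagExp_none] using add_le_add (h τ) hxy
    · simpa [diagExp_some] using h j

theorem diagExp_add_single_sub (τ : ι) {a m : ι →₀ ℕ} {x y : ℕ} (hxy : x ≤ y) (ham : a ≤ m) :
    diagExp τ m + Finsupp.single none y - (diagExp τ a + Finsupp.single none x) =
      diagExp τ (m - a) + Finsupp.single none (y - x) := by
  ext (_ | j)
  · have := ham τ
    simp [diagExp_none]
    omega
  · simp [diagExp_some]

/-- Dividing out the monomial leaves an excess of $e-k\in\{1,\dots,e\}$ in the exponent of $s$,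
where the operator gives zero. -/
theorem coeff_monomial_mul_antidiagOp_of_lt (τ : ι) (h : MvPowerSeries (Option ι) ℚ)
    (a m : ι →₀ ℕ) {N k e : ℕ} (hke : k < e) (heN : e ≤ N) :
    coeff (diagExp τ m + Finsupp.single none (N - k))
      (monomial (diagExp τ a + Finsupp.single none (N - e)) 1 * antidiagOp τ h e) = 0 := by
  classical
  simp only [coeff_monomial_mul, diagExp_add_single_le_iff τ (show N - e ≤ N - k by omega)]
  split_ifs with ham
  · rw [diagExp_add_single_sub τ (by omega) ham, coeff_antidiagOp,
      Finset.prod_eq_zero (i := e - k - 1) (Finset.mem_range.2 (by omega)), zero_mul, mul_zero]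
    rw [show N - k - (N - e) = e - k - 1 + 1 by omega]
    simp only [Finsupp.add_apply, diagExp_none, diagExp_some, Finsupp.single_eq_same]
    simp
  · rfl

theorem coeff_monomial_mul_antidiagOp_self (τ : ι) (h : MvPowerSeries (Option ι) ℚ)
    (a m : ι →₀ ℕ) (k N : ℕ) :
    coeff (diagExp τ m + Finsupp.single none (N - k))
      (monomial (diagExp τ a + Finsupp.single none (N - k)) 1 * antidiagOp τ h k) =
      (∏ j ∈ Finset.range k, (-((j : ℚ) + 1))) * coeff m (monomial a 1 * diagonal τ h) := by
  classical
  simp only [coeff_monomial_mul, diagExp_add_single_le_iff τ (le_refl (N - k))]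
  split_ifs with ham
  · rw [diagExp_add_single_sub τ le_rfl ham, coeff_antidiagOp]
    simp [diagExp_none, diagExp_some, coeff_diagonal]
  · rw [mul_zero]

/-- If a nontrivial combination of the series `x^a s^(N-e) (D - e) ⋯ (D - 1) x_i^f ∂_i^f G`
vanishes, then the diagonal of `G` is D-finite with respect to `x_i`. -/
theorem dFiniteWrt_diagonal_of_relation {A : Type*} [Fintype A] (a : A → ι →₀ ℕ)
    (ha : Function.Injective a) (τ i : ι) (G : MvPowerSeries (Option ι) ℚ) (N : ℕ)
    (c : A × Fin (N + 1) × Fin (N + 1) → ℚ) (hc : ∃ p, c p ≠ 0)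
    (hrel : ∑ p, c p • (monomial (diagExp τ (a p.1) + Finsupp.single none (N - p.2.1)) 1 *
      antidiagOp τ (X (some i) ^ (p.2.2 : ℕ) * (pderiv ℚ (some i))^[p.2.2] G) p.2.1) = 0) :
    DFiniteWrt i (diagonal τ G) := by
  classical
  -- With $k$ minimal, the coefficients at excess $N-k$ see only the terms $e=k$: those with $e<k$
  -- are absent and those with $e>k$ are killed. What remains is $(-1)^kk!$ times a relation for the
  -- diagonal.
  obtain ⟨k, ⟨⟨a0, f0, hk⟩, hmin⟩⟩ : ∃ k : Fin (N + 1), (∃ x f, c (x, k, f) ≠ 0) ∧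
      ∀ e < k, ∀ x f, c (x, e, f) = 0 := by
    obtain ⟨⟨x, e, f⟩, hp⟩ := hc
    obtain ⟨k, hk, hmin⟩ := WellFounded.has_min (wellFounded_lt (α := Fin (N + 1)))
      {k | ∃ x f, c (x, k, f) ≠ 0} ⟨e, x, f, hp⟩
    refine ⟨k, hk, fun e he x f => ?_⟩
    by_contra h
    exact hmin e ⟨x, f, h⟩ he
  have hz : ∑ f : Fin (N + 1), ∑ x, c (x, k, f) •
      (monomial (a x) 1 * (X i ^ (f : ℕ) * (pderiv ℚ i)^[f] (diagonal τ G))) = 0 := by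
    ext m
    have h1 := congrArg (coeff (diagExp τ m + Finsupp.single none (N - k))) hrel
    rw [map_sum, Fintype.sum_prod_type, Finset.sum_comm' (t' := Finset.univ)
      (s' := fun _ => Finset.univ) (by simp), Fintype.sum_prod_type,
      Finset.sum_eq_single k] at h1
    · simp only [map_smul, coeff_monomial_mul_antidiagOp_self,
        diagonal_X_pow_mul_iterate_pderiv, smul_eq_mul, mul_left_comm (c _),
        ← Finset.mul_sum, map_zero] at h1
      have h2 : (∏ j ∈ Finset.range k, (-((j : ℚ) + 1))) ≠ 0 :=
        Finset.prod_ne_zero_iff.2 fun j _ => neg_ne_zero.2 (by positivity)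
      simpa [map_sum] using (mul_eq_zero.1 h1).resolve_left h2
    · intro e _ hek
      refine Finset.sum_eq_zero fun f _ => Finset.sum_eq_zero fun x _ => ?_
      rcases lt_or_gt_of_ne hek with h | h
      · rw [hmin e h, zero_smul, map_zero]
      · rw [map_smul, coeff_monomial_mul_antidiagOp_of_lt τ _ _ _ h (by omega), smul_zero]
    · simp
  let p : ℕ → MvPolynomial ι ℚ := fun f => if hf : f < N + 1 then
    (∑ x, MvPolynomial.monomial (a x) (c (x, k, ⟨f, hf⟩))) * MvPolynomial.X i ^ f else 0
  have hpf : ∀ f : Fin (N + 1), p f =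
      (∑ x, MvPolynomial.monomial (a x) (c (x, k, f))) * MvPolynomial.X i ^ (f : ℕ) := by
    intro f
    simp only [p, f.2, dif_pos]
  refine DFiniteWrt.of_relation (n := N + 1) p ⟨f0, Finset.mem_range.2 f0.2, ?_⟩ ?_
  · rw [hpf]
    -- Distinct monomials $x^a$ cannot cancel, so the coefficient of the `f0`-th derivative is
    -- nonzero.
    refine mul_ne_zero (fun h => hk ?_) (pow_ne_zero _ (MvPolynomial.X_ne_zero i))
    have h1 := congrArg (MvPolynomial.coeff (a a0)) h
    rw [MvPolynomial.coeff_sum, Finset.sum_eq_single a0] at h1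
    · simpa using h1
    · intro x _ hx
      rw [MvPolynomial.coeff_monomial, if_neg (fun h => hx (ha h))]
    · simp
  · rw [Finset.sum_range, ← hz]
    refine Finset.sum_congr rfl fun f _ => ?_
    rw [hpf, mul_smul, Finset.sum_smul]
    refine Finset.sum_congr rfl fun x _ => ?_
    rw [poly_smul_eq, poly_smul_eq, MvPolynomial.coe_pow, MvPolynomial.coe_X,
      MvPolynomial.coe_monomial, ← smul_mul_assoc, ← map_smul, smul_eq_mul, mul_one]

theorem Holonomic.exists_generators {σ : Type} [Fintype σ] {G : MvPowerSeries σ ℚ}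
    (hG : Holonomic G) : ∃ (r : ℕ) (b : Fin r → MvPowerSeries σ ℚ) (q : MvPolynomial σ ℚ),
      q ≠ 0 ∧ G ∈ Submodule.span (MvPolynomial σ ℚ) (Set.range b) ∧
      ∀ i k, (q : MvPowerSeries σ ℚ) * pderiv ℚ i (b k) ∈
        Submodule.span (MvPolynomial σ ℚ) (Set.range b) := by
  classical
  obtain ⟨N, hN, hGN, hdN⟩ := hG
  obtain ⟨r, b, rfl⟩ := Submodule.fg_iff_exists_fin_generating_family.1 hN
  choose q hq hqN using fun p : σ × Fin r => hdN p.1 (b p.2) (Submodule.subset_span ⟨p.2, rfl⟩)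
  refine ⟨r, b, ∏ p, q p, Finset.prod_ne_zero_iff.2 fun p _ => hq p, hGN, fun i k => ?_⟩
  rw [← poly_smul_eq, ← Finset.prod_erase_mul _ _ (Finset.mem_univ (i, k)), mul_smul]
  exact Submodule.smul_mem _ _ (hqN (i, k))

theorem PoleFiltration.antidiagOp_mem {q : MvPolynomial (Option ι) ℚ} {c d : ℕ}
    {E : ℕ → Submodule ℚ (MvPowerSeries (Option ι) ℚ)} (hE : PoleFiltration q c E) {n : ℕ}
    {h : MvPowerSeries (Option ι) ℚ} (hh : h ∈ poleLevel q c E d n) (τ : ι) (e : ℕ) :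
    antidiagOp τ h e ∈ poleLevel q c E d (n + 2 * e) := by
  induction e with
  | zero => exact hh
  | succ e ih =>
    exact Submodule.sub_mem _ (Submodule.sub_mem _ (hE.X_mul_mem (hE.pderiv_mem ih _) _)
      (hE.X_mul_mem (hE.pderiv_mem ih _) _))
      (Submodule.smul_mem _ _ (hE.poleLevel_mono (by omega) ih))

theorem PoleFiltration.iterate_pderiv_mem {σ : Type} {q : MvPolynomial σ ℚ} {c d : ℕ}
    {E : ℕ → Submodule ℚ (MvPowerSeries σ ℚ)} (hE : PoleFiltration q c E) {n : ℕ}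
    {h : MvPowerSeries σ ℚ} (hh : h ∈ poleLevel q c E d n) (i : σ) (f : ℕ) :
    (pderiv ℚ i)^[f] h ∈ poleLevel q c E d (n + f) := by
  induction f with
  | zero => exact hh
  | succ f ih => rw [Function.iterate_succ_apply']; exact hE.pderiv_mem ih i

/-- The diagonal of a D-finite series is D-finite. -/
theorem Holonomic.dFinite_diagonal [Fintype ι] (τ : ι) {G : MvPowerSeries (Option ι) ℚ}
    (hG : Holonomic G) : DFinite (diagonal τ G) := by
  classical
  intro i
  obtain ⟨r, b, q, hq, hGb, hqb⟩ := hG.exists_generators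
  obtain ⟨c, hE⟩ := exists_poleFiltration hqb
  obtain ⟨d, hd⟩ := exists_mem_boxSpan hGb
  set l := Fintype.card ι with hl
  -- Each vector below uses at most $2lN+(N-e)+2e+2f\le CN$ multiplications by variables and
  -- differentiations. `K` gives $d+cCN+1\le K(N+1)$, and `N` is chosen so that $K^{l+1}r=N<N+1$.
  set C := 2 * l + 5 with hC
  set K := d + c * C + 1 with hK
  set N := K ^ (l + 1) * r with hN
  let a : (ι → Fin (N + 1)) → ι →₀ ℕ := fun x => Finsupp.equivFunOnFinite.symm fun j => x j
  have ha : Function.Injective a := by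
    intro x y hxy
    ext j
    exact DFunLike.congr_fun hxy j
  have hdeg : ∀ x, (a x).degree ≤ l * N := by
    intro x
    rw [Finsupp.degree_eq_sum]
    refine (Finset.sum_le_card_nsmul _ _ N fun j _ => ?_).trans (by simp [hl])
    simpa [a] using Nat.lt_succ_iff.1 (x j).2
  let v : (ι → Fin (N + 1)) × Fin (N + 1) × Fin (N + 1) → MvPowerSeries (Option ι) ℚ := fun p =>
    monomial (diagExp τ (a p.1) + Finsupp.single none (N - p.2.1)) 1 *
      antidiagOp τ (X (some i) ^ (p.2.2 : ℕ) * (pderiv ℚ (some i))^[p.2.2] G) p.2.1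
  have hv : ∀ p, v p ∈ poleLevel q c (boxSpan b) d (C * N) := by
    rintro ⟨x, e, f⟩
    have h0 : G ∈ poleLevel q c (boxSpan b) d 0 := by
      rw [mem_poleLevel]
      simpa using hd
    have h1 := hE.monomial_mul_mem (hE.iterate_pderiv_mem h0 (some i) f) (Finsupp.single (some i) f)
    rw [← X_pow_eq] at h1
    refine hE.poleLevel_mono ?_ (hE.monomial_mul_mem (hE.antidiagOp_mem h1 τ e) _)
    rw [map_add, Finsupp.degree_single, Finsupp.degree_single]
    have h2 := degree_diagExp_le τ (a x)
    have h3 := hdeg x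
    have h4 : C * N = 2 * (l * N) + 5 * N := by rw [hC]; ring
    have := e.2
    have := f.2
    dsimp only
    omega
  -- There are $(N+1)^{l+2}$ vectors, and multiplication by $q^{CN}$ embeds their span in dimension
  -- at most $(d+cCN+1)^{l+1}r\le(N+1)^{l+1}N$.
  by_cases hli : LinearIndependent ℚ v
  · exfalso
    have hinj : Function.Injective
        (LinearMap.mulLeft ℚ ((q : MvPowerSeries (Option ι) ℚ) ^ (C * N))) := by
      intro x y hxy
      exact mul_left_cancel₀ (pow_ne_zero _ (mt MvPolynomial.coe_eq_zero_iff.1 hq)) hxy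
    have hli2 := hli.map' _ (LinearMap.ker_eq_bot.2 hinj)
    have hli3 : LinearIndependent ℚ fun p => (⟨_, hv p⟩ : boxSpan b (d + c * (C * N))) :=
      LinearIndependent.of_comp (boxSpan b (d + c * (C * N))).subtype hli2
    have h1 := hli3.fintype_card_le_finrank.trans (finrank_boxSpan_le _)
    rw [Fintype.card_prod, Fintype.card_prod, Fintype.card_fun, Fintype.card_fin,
      Fintype.card_option, ← hl] at h1
    have h2 : d + c * (C * N) + 1 ≤ K * (N + 1) := by
      rw [hK]
      nlinarith [Nat.zero_le (d * N), Nat.zero_le (c * C), Nat.zero_le N]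
    have h3 : (N + 1) ^ (l + 1) * (N + 1) ≤ (N + 1) ^ (l + 1) * N := by
      calc (N + 1) ^ (l + 1) * (N + 1) = (N + 1) ^ l * ((N + 1) * (N + 1)) := by ring
        _ ≤ (d + c * (C * N) + 1) ^ (l + 1) * r := h1
        _ ≤ (K * (N + 1)) ^ (l + 1) * r := by gcongr
        _ = (N + 1) ^ (l + 1) * N := by rw [hN, mul_pow]; ring
    exact absurd (Nat.le_of_mul_le_mul_left h3 (by positivity)) (by omega)
  · obtain ⟨g, hg, p, hp⟩ := Fintype.not_linearIndependent_iff.1 hli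
    exact dFiniteWrt_diagonal_of_relation a ha τ i G N g ⟨p, hp⟩ hg

end Diagonal

/-! ### The kernel method for half-line walks. -/

section KernelMethod

variable {σ : Type}

theorem pderiv_eq_zero_iff {x : σ} {B : MvPowerSeries σ ℚ} :
    pderiv ℚ x B = 0 ↔ ∀ m, coeff (m + Finsupp.single x 1) B = 0 := by
  rw [MvPowerSeries.ext_iff]
  refine forall_congr' fun m => ?_
  rw [coeff_pderiv, map_zero, mul_eq_zero]
  exact or_iff_left (by positivity)

/-- The coefficients of $xE$ and $tSE$ agree on monomials divisible by $x$, so $t^n\mid E$ implies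
$t^{n+1}\mid E$. -/
theorem eq_zero_of_kernel_equation {x t : σ} (hxt : x ≠ t) (S : MvPowerSeries σ ℚ)
    {E : MvPowerSeries σ ℚ} (hE : pderiv ℚ x (X x * E - X t * S * E) = 0) : E = 0 := by
  classical
  rw [pderiv_eq_zero_iff] at hE
  have hdvd : ∀ n, X t ^ n ∣ E := by
    intro n
    induction n with
    | zero => simp
    | succ n ih =>
      rw [X_pow_dvd_iff]
      intro m hm
      have h1 : X t ^ (n + 1) ∣ X t * S * E := by
        rw [pow_succ', mul_assoc]
        exact mul_dvd_mul_left _ (ih.mul_left _)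
      have h2 := X_pow_dvd_iff.1 h1 (m + Finsupp.single x 1)
        (by simpa [Finsupp.single_eq_of_ne hxt.symm] using hm)
      have h3 := hE m
      rwa [map_sub, h2, sub_zero, add_comm, X_def, coeff_add_monomial_mul, one_mul] at h3
  ext m
  exact X_pow_dvd_iff.1 (hdvd (m t + 1)) m (Nat.lt_succ_self _)

/-- Take $A=g^{-1}\,\mathrm{Cat}(e g^{-2})$, where $\mathrm{Cat}(w)=1+w\,\mathrm{Cat}(w)^2$. -/
theorem exists_catalan_solution (g e : MvPolynomial σ ℚ)
    (hg : constantCoeff (g : MvPowerSeries σ ℚ) ≠ 0)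
    (he : constantCoeff (e : MvPowerSeries σ ℚ) = 0) :
    ∃ A : MvPowerSeries σ ℚ, g * A = 1 + e * A ^ 2 := by
  set i : MvPowerSeries σ ℚ := (g : MvPowerSeries σ ℚ)⁻¹ with hi
  have hgi : (g : MvPowerSeries σ ℚ) * i = 1 := MvPowerSeries.mul_inv_cancel _ hg
  set w : MvPowerSeries σ ℚ := e * i ^ 2 with hw
  have hsub : PowerSeries.HasSubst w :=
    PowerSeries.HasSubst.of_constantCoeff_zero (by rw [hw, map_mul, he, zero_mul])
  set c : PowerSeries ℚ := PowerSeries.catalanSeries.map (Nat.castRingHom ℚ) with hc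
  have hcat : c ^ 2 * PowerSeries.X + 1 = c := by
    have := congrArg (PowerSeries.map (Nat.castRingHom ℚ))
      PowerSeries.catalanSeries_sq_mul_X_add_one
    simpa using this
  have hcat' := congrArg (PowerSeries.substAlgHom hsub) hcat
  rw [map_add, map_mul, map_pow, map_one, PowerSeries.substAlgHom_X] at hcat'
  refine ⟨i * PowerSeries.substAlgHom hsub c, ?_⟩
  linear_combination (PowerSeries.substAlgHom hsub c) * hgi - hcat' +
    (PowerSeries.substAlgHom hsub c) ^ 2 * hw

theorem isAlgebraic_of_quadratic {g e : MvPolynomial σ ℚ} {A : MvPowerSeries σ ℚ}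
    (hA : g * A = 1 + e * A ^ 2) : IsAlgebraic (MvPolynomial σ ℚ) A := by
  refine ⟨Polynomial.C e * Polynomial.X ^ 2 - Polynomial.C g * Polynomial.X + 1, ?_, ?_⟩
  · intro h
    have := congrArg (fun p => Polynomial.coeff p 0) h
    simp at this
  · simp only [map_add, map_sub, map_mul, map_pow, Polynomial.aeval_C, Polynomial.aeval_X, map_one,
      polyAlgebraMap_eq_coe]
    linear_combination -hA

theorem isAlgebraic_of_mul_eq_one {D H : MvPowerSeries σ ℚ}
    (hD : IsAlgebraic (MvPolynomial σ ℚ) D) (hDH : D * H = 1) :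
    IsAlgebraic (MvPolynomial σ ℚ) H := by
  have : Invertible D := ⟨H, by rw [mul_comm, hDH], hDH⟩
  have h1 := hD.invOf
  rwa [show ⅟D = H from invOf_eq_right_inv hDH] at h1

theorem isAlgebraic_coe (p : MvPolynomial σ ℚ) :
    IsAlgebraic (MvPolynomial σ ℚ) (p : MvPowerSeries σ ℚ) := by
  rw [← polyAlgebraMap_eq_coe]
  exact isAlgebraic_algebraMap p

/-- A series satisfying the functional equation of walks on the half-line with steps `-1`, `0`,
`1` of weights `a`, `b`, `c` is algebraic. -/
theorem isAlgebraic_of_kernel_equation {x t : σ} (hxt : x ≠ t) {a b c : MvPolynomial σ ℚ}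
    (ha : MvPolynomial.pderiv x a = 0) (hb : MvPolynomial.pderiv x b = 0)
    (hc : MvPolynomial.pderiv x c = 0) {F : MvPowerSeries σ ℚ}
    (hF : pderiv ℚ x (X x * F - X x -
      X t * ((a : MvPowerSeries σ ℚ) + (b : MvPowerSeries σ ℚ) * X x +
        (c : MvPowerSeries σ ℚ) * X x ^ 2) * F) = 0) :
    IsAlgebraic (MvPolynomial σ ℚ) F := by
  classical
  set e : MvPolynomial σ ℚ := MvPolynomial.X t ^ 2 * a * c with he
  set g : MvPolynomial σ ℚ := 1 - MvPolynomial.X t * b with hg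
  have heq : (e : MvPowerSeries σ ℚ) = X t ^ 2 * (a : MvPowerSeries σ ℚ) * (c : MvPowerSeries σ ℚ) := by
    simp [he]
  have hgq : (g : MvPowerSeries σ ℚ) = 1 - X t * (b : MvPowerSeries σ ℚ) := by
    rw [eq_sub_iff_add_eq, ← MvPolynomial.coe_X, ← MvPolynomial.coe_mul, ← MvPolynomial.coe_add,
      ← MvPolynomial.coe_one, hg]
    congr 1
    ring
  obtain ⟨A, hA⟩ := exists_catalan_solution g e (by simp [hgq]) (by simp [heq])
  have hAalg := isAlgebraic_of_quadratic hA
  -- The kernel $x-t(a+bx+cx^2)$ has the root $x=taA$ and factors as $(x-taA)D$. Thus $D^{-1}$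
  -- solves the functional equation with boundary term $-taA$, and `F` will be $D^{-1}$.
  set D : MvPowerSeries σ ℚ := (g : MvPowerSeries σ ℚ) -
    X t * (c : MvPowerSeries σ ℚ) * X x - (e : MvPowerSeries σ ℚ) * A with hD
  have hD0 : constantCoeff D ≠ 0 := by simp [hD, hgq, heq]
  have hDalg : IsAlgebraic (MvPolynomial σ ℚ) D := by
    refine ((isAlgebraic_coe g).sub ?_).sub ((isAlgebraic_coe e).mul hAalg)
    rw [← MvPolynomial.coe_X, ← MvPolynomial.coe_X, ← MvPolynomial.coe_mul, ← MvPolynomial.coe_mul]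
    exact isAlgebraic_coe _
  have hDH : D * D⁻¹ = 1 := MvPowerSeries.mul_inv_cancel _ hD0
  have hax : pderiv ℚ x (a : MvPowerSeries σ ℚ) = 0 := by
    rw [pderiv_coe, ha, MvPolynomial.coe_zero]
  have hbx : pderiv ℚ x (b : MvPowerSeries σ ℚ) = 0 := by
    rw [pderiv_coe, hb, MvPolynomial.coe_zero]
  have hcx : pderiv ℚ x (c : MvPowerSeries σ ℚ) = 0 := by
    rw [pderiv_coe, hc, MvPolynomial.coe_zero]
  have htx : pderiv ℚ x (X t : MvPowerSeries σ ℚ) = 0 := pderiv_X_of_ne hxt.symm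
  have hAx : pderiv ℚ x A = 0 := by
    have h1 := congrArg (pderiv ℚ x) hA
    rw [hgq, heq] at h1
    simp only [Derivation.leibniz, map_sub, map_add, Derivation.leibniz_pow, hax, hbx, hcx, htx,
      Derivation.map_one_eq_zero, smul_eq_mul, smul_zero, mul_zero, add_zero, zero_add, sub_zero,
      nsmul_eq_mul] at h1
    -- Differentiating the quadratic gives $(g-2eA)\,\partial_xA=0$, whose first factor has constant
    -- term $1$.
    have h2 : (1 - X t * (b : MvPowerSeries σ ℚ) - 2 * (X t ^ 2 * (a : MvPowerSeries σ ℚ) * (c : MvPowerSeries σ ℚ)) * A) *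
        pderiv ℚ x A = 0 := by
      push_cast at h1
      linear_combination h1
    refine (mul_eq_zero.1 h2).resolve_left fun h => ?_
    have := congrArg constantCoeff h
    simp at this
  have hH : X x * D⁻¹ - X x - X t * ((a : MvPowerSeries σ ℚ) + (b : MvPowerSeries σ ℚ) * X x +
        (c : MvPowerSeries σ ℚ) * X x ^ 2) * D⁻¹ =
      -(X t * (a : MvPowerSeries σ ℚ) * A) := by
    have h1 : X x - X t * ((a : MvPowerSeries σ ℚ) + (b : MvPowerSeries σ ℚ) * X x +
        (c : MvPowerSeries σ ℚ) * X x ^ 2) =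
        (X x - X t * (a : MvPowerSeries σ ℚ) * A) * D := by
      rw [hD, heq]
      rw [heq] at hA
      linear_combination (X t * (a : MvPowerSeries σ ℚ)) * hA - X x * hgq
    linear_combination D⁻¹ * h1 + (X x - X t * (a : MvPowerSeries σ ℚ) * A) * hDH
  have hFD : F - D⁻¹ = 0 := by
    refine eq_zero_of_kernel_equation hxt
      ((a : MvPowerSeries σ ℚ) + (b : MvPowerSeries σ ℚ) * X x +
        (c : MvPowerSeries σ ℚ) * X x ^ 2) ?_
    have h1 : X x * (F - D⁻¹) - X t * ((a : MvPowerSeries σ ℚ) + (b : MvPowerSeries σ ℚ) * X x +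
        (c : MvPowerSeries σ ℚ) * X x ^ 2) *
        (F - D⁻¹) = (X x * F - X x - X t * ((a : MvPowerSeries σ ℚ) + (b : MvPowerSeries σ ℚ) * X x +
        (c : MvPowerSeries σ ℚ) * X x ^ 2) * F) +
        X t * (a : MvPowerSeries σ ℚ) * A := by
      linear_combination -hH
    rw [h1, map_add, hF, zero_add]
    simp [Derivation.leibniz, hax, htx, hAx]
  rw [sub_eq_zero.1 hFD]
  exact isAlgebraic_of_mul_eq_one hDalg hDH

end KernelMethod

/-! ### Last-step recurrences for confined walks. -/

section StepCount

variable {α Γ : Type*} [AddCommGroup Γ]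

/-- The lists of `n` letters of `Ω` with displacements `φ` whose partial sums all lie in `P` and
whose total displacement is `γ`. -/
def confinedWalks (Ω : Set α) (φ : α → Γ) (P : Set Γ) (γ : Γ) (n : ℕ) : Set (List α) :=
  {w | (∀ s ∈ w, s ∈ Ω) ∧ (∀ p, p <+: w → (p.map φ).sum ∈ P) ∧ w.length = n ∧ (w.map φ).sum = γ}

/-- The number of walks in `confinedWalks Ω φ P γ n`. -/
noncomputable def stepCount (Ω : Set α) (φ : α → Γ) (P : Set Γ) (γ : Γ) (n : ℕ) : ℕ :=
  (confinedWalks Ω φ P γ n).ncard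

variable {Ω : Set α} {φ : α → Γ} {P : Set Γ}

theorem stepCount_of_notMem {γ : Γ} (h : γ ∉ P) (n : ℕ) : stepCount Ω φ P γ n = 0 := by
  have : confinedWalks Ω φ P γ n = ∅ := by
    refine Set.eq_empty_of_forall_notMem fun w hw => h ?_
    rw [← hw.2.2.2]
    exact hw.2.1 w List.prefix_rfl
  rw [stepCount, this, Set.ncard_empty]

open Classical in
theorem stepCount_zero (hP : 0 ∈ P) (γ : Γ) : stepCount Ω φ P γ 0 = if γ = 0 then 1 else 0 := by
  split_ifs with h
  · have : confinedWalks Ω φ P γ 0 = {[]} := by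
      ext w
      constructor
      · exact fun hw => List.eq_nil_of_length_eq_zero hw.2.2.1
      · rintro rfl
        refine ⟨by simp, fun p hp => ?_, rfl, by simp [h]⟩
        rw [List.prefix_nil.1 hp]
        simpa using hP
    rw [stepCount, this, Set.ncard_singleton]
  · have : confinedWalks Ω φ P γ 0 = ∅ := by
      refine Set.eq_empty_of_forall_notMem fun w hw => h ?_
      rw [← hw.2.2.2, List.eq_nil_of_length_eq_zero hw.2.2.1]
      simp
    rw [stepCount, this, Set.ncard_empty]

theorem confinedWalks_succ {γ : Γ} (hγ : γ ∈ P) (n : ℕ) :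
    confinedWalks Ω φ P γ (n + 1) =
      ⋃ s ∈ Ω, (fun w => w ++ [s]) '' confinedWalks Ω φ P (γ - φ s) n := by
  ext w
  simp only [Set.mem_iUnion, Set.mem_image, exists_prop]
  constructor
  · rintro ⟨h1, h2, h3, h4⟩
    rcases List.eq_nil_or_concat' w with rfl | ⟨w, s, rfl⟩
    · simp at h3
    · refine ⟨s, h1 s (by simp), w, ⟨fun s' hs' => h1 s' (by simp [hs']), fun p hp =>
        h2 p (hp.trans (List.prefix_append _ _)), by simpa using h3, ?_⟩, rfl⟩
      rw [← h4]
      simp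
  · rintro ⟨s, hs, w, ⟨h1, h2, h3, h4⟩, rfl⟩
    have h5 : ((w ++ [s]).map φ).sum = γ := by simp [h4]
    refine ⟨?_, fun p hp => ?_, by simp [h3], h5⟩
    · intro s' hs'
      rcases List.mem_append.1 hs' with h | h
      · exact h1 s' h
      · rwa [List.mem_singleton.1 h]
    · rcases List.prefix_concat_iff.1 hp with rfl | h
      · rwa [h5]
      · exact h2 p h

theorem finite_confinedWalks (hΩ : Ω.Finite) (γ : Γ) (n : ℕ) :
    (confinedWalks Ω φ P γ n).Finite := by
  induction n generalizing γ with
  | zero =>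
    refine (Set.finite_singleton []).subset fun w hw => ?_
    exact List.eq_nil_of_length_eq_zero hw.2.2.1
  | succ n ih =>
    by_cases hγ : γ ∈ P
    · rw [confinedWalks_succ hγ]
      exact hΩ.biUnion fun s _ => (ih _).image _
    · refine Set.finite_empty.subset fun w hw => hγ ?_
      rw [← hw.2.2.2]
      exact hw.2.1 w List.prefix_rfl

theorem stepCount_succ (hΩ : Ω.Finite) {γ : Γ} (hγ : γ ∈ P) (n : ℕ) :
    stepCount Ω φ P γ (n + 1) = ∑ s ∈ hΩ.toFinset, stepCount Ω φ P (γ - φ s) n := by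
  classical
  have hfin := fun γ' => finite_confinedWalks (φ := φ) (P := P) hΩ γ' n
  have h1 : confinedWalks Ω φ P γ (n + 1) = ((hΩ.toFinset.biUnion fun s =>
      (hfin (γ - φ s)).toFinset.image fun w => w ++ [s] : Finset (List α)) : Set (List α)) := by
    rw [confinedWalks_succ hγ]
    ext w
    simp
  rw [stepCount, h1, Set.ncard_coe_finset, Finset.card_biUnion]
  · refine Finset.sum_congr rfl fun s _ => ?_
    rw [Finset.card_image_of_injective _ (List.append_left_injective [s]), stepCount,
      Set.ncard_eq_toFinset_card _ (hfin _)]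
  · intro s _ s' _ hss'
    rw [Function.onFun, Finset.disjoint_left]
    intro w hw hw'
    obtain ⟨a, -, rfl⟩ := Finset.mem_image.1 hw
    obtain ⟨b, -, hb⟩ := Finset.mem_image.1 hw'
    exact hss' (by simpa using (List.append_inj_right' hb rfl).symm)

end StepCount

/-! ### Octant walks as pairs of a coloured walk and a quadrant walk. -/

section WalkCounts

/-- The number of walks in the orthant with a given integral end point. -/
noncomputable def intWalkCount {D : ℕ} (S : Set (Fin D → ℤ)) (e : Fin D → ℤ) (n : ℕ) : ℕ :=
  stepCount S id (Set.Ici 0) e n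

theorem walkCount_eq_intWalkCount {D : ℕ} (S : Set (Fin D → ℤ)) (e : Fin D → ℕ) (n : ℕ) :
    walkCount S e n = intWalkCount S (fun i => (e i : ℤ)) n := by
  rw [walkCount, intWalkCount, stepCount]
  congr 1
  ext w
  simp [orthantWalks, confinedWalks, and_assoc]

/-- The steps of coloured walks. -/
def colouredSteps {d : ℕ} (U V : Set (Fin d → ℤ)) : Set ((Fin d → ℤ) × Bool) :=
  {s | s.1 ∈ U ∧ s.2 = false ∨ s.1 ∈ V ∧ s.2 = true}

/-- The number of coloured walks with `n` steps, `k` of them black, ending at `e`. -/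
noncomputable def intColouredCount {d : ℕ} (U V : Set (Fin d → ℤ)) (e : Fin d → ℤ) (k : ℤ)
    (n : ℕ) : ℕ :=
  stepCount (colouredSteps U V) (fun s => (s.1, if s.2 then (1 : ℤ) else 0))
    {γ : (Fin d → ℤ) × ℤ | 0 ≤ γ.1} (e, k) n

theorem mem_colouredSteps_iff {d : ℕ} {U V : Set (Fin d → ℤ)} {s : (Fin d → ℤ) × Bool} :
    s ∈ colouredSteps U V ↔
      s.1 ∈ U ∪ V ∧ (s.1 ∈ U \ V → s.2 = false) ∧ (s.1 ∈ V \ U → s.2 = true) := by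
  obtain ⟨s, b⟩ := s
  cases b <;> simp [colouredSteps] <;> tauto

theorem sum_map_colour {d : ℕ} (w : List ((Fin d → ℤ) × Bool)) :
    (w.map fun s => (s.1, if s.2 then (1 : ℤ) else 0)).sum =
      ((w.map Prod.fst).sum, ((w.map Prod.snd).count true : ℤ)) := by
  induction w with
  | nil => rfl
  | cons s w ih =>
    obtain ⟨s, b⟩ := s
    cases b <;> simp [ih, add_comm]

theorem colouredCount_eq_intColouredCount {d : ℕ} (U V : Set (Fin d → ℤ)) (e : Fin d → ℕ)
    (k n : ℕ) : colouredCount U V e k n = intColouredCount U V (fun i => (e i : ℤ)) k n := by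
  rw [colouredCount, intColouredCount, stepCount]
  congr 1
  ext w
  simp only [colouredWalks, orthantWalks, confinedWalks, Set.mem_ofPred_eq, sum_map_colour,
    mem_colouredSteps_iff, Prod.mk.injEq, Nat.cast_inj, List.forall_mem_map]
  constructor
  · rintro ⟨⟨⟨h1, h2⟩, h3⟩, h4, h5, h6⟩
    exact ⟨fun s hs => ⟨h1 s hs, h3 s hs⟩, fun p hp => h2 _ (hp.map _), h4, h6, h5⟩
  · rintro ⟨h1, h2, h4, h6, h5⟩
    refine ⟨⟨⟨fun s hs => (h1 s hs).1, fun p hp => ?_⟩, fun s hs => (h1 s hs).2⟩, h4, h5, h6⟩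
    obtain ⟨p', hp', rfl⟩ := List.prefix_map_iff.1 hp
    exact h2 p' hp'

variable {d δ : ℕ} {U V : Set (Fin d → ℤ)} {T : Set (Fin δ → ℤ)}

theorem finite_smallSteps (D : ℕ) : (smallSteps D).Finite :=
  Set.Finite.pi' fun _ => Set.toFinite _

open Classical in
theorem intColouredCount_zero (e : Fin d → ℤ) (k : ℤ) :
    intColouredCount U V e k 0 = if e = 0 ∧ k = 0 then 1 else 0 := by
  rw [intColouredCount, stepCount_zero (by simp)]
  simp [Prod.ext_iff]

theorem intColouredCount_of_not_nonneg {e : Fin d → ℤ} (he : ¬ 0 ≤ e) (k : ℤ) (n : ℕ) :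
    intColouredCount U V e k n = 0 := stepCount_of_notMem he n

theorem intColouredCount_succ (hU : U.Finite) (hV : V.Finite) {e : Fin d → ℤ} (he : 0 ≤ e)
    (k : ℤ) (n : ℕ) :
    intColouredCount U V e k (n + 1) = ∑ u ∈ hU.toFinset, intColouredCount U V (e - u) k n +
      ∑ v ∈ hV.toFinset, intColouredCount U V (e - v) (k - 1) n := by
  classical
  have hfin : (colouredSteps U V).Finite := by
    refine ((hU.union hV).prod (Set.finite_univ (α := Bool))).subset ?_
    rintro s (⟨h, -⟩ | ⟨h, -⟩)
    · exact ⟨Or.inl h, trivial⟩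
    · exact ⟨Or.inr h, trivial⟩
  have h1 : hfin.toFinset = hU.toFinset.image (fun u => (u, false)) ∪
      hV.toFinset.image (fun v => (v, true)) := by
    ext ⟨s, b⟩
    cases b <;> simp [colouredSteps]
  rw [intColouredCount, stepCount_succ hfin (by exact he), h1, Finset.sum_union,
    Finset.sum_image (by simp), Finset.sum_image (by simp)]
  · simp [intColouredCount]
  · rw [Finset.disjoint_left]
    simp

/-- With an integral number of black steps, the boundary terms of the recurrences simply vanish. -/
theorem intColouredCount_of_lt (hU : U.Finite) (hV : V.Finite) (e : Fin d → ℤ) {k : ℤ} {n : ℕ}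
    (hk : k < 0 ∨ (n : ℤ) < k) : intColouredCount U V e k n = 0 := by
  induction n generalizing e k with
  | zero =>
    rw [intColouredCount_zero, if_neg]
    push_cast at hk
    omega
  | succ n ih =>
    by_cases he : 0 ≤ e
    · rw [intColouredCount_succ hU hV he]
      push_cast at hk
      rw [Finset.sum_eq_zero fun u _ => ih _ (by omega),
        Finset.sum_eq_zero fun v _ => ih _ (by omega), add_zero]
    · exact intColouredCount_of_not_nonneg he _ _

theorem intWalkCount_zero {D : ℕ} (S : Set (Fin D → ℤ)) (e : Fin D → ℤ) :
    intWalkCount S e 0 = if e = 0 then 1 else 0 := by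
  rw [intWalkCount, stepCount_zero (Set.mem_Ici.2 le_rfl)]
  congr

theorem intWalkCount_of_not_nonneg {D : ℕ} (S : Set (Fin D → ℤ)) {e : Fin D → ℤ} (he : ¬ 0 ≤ e)
    (n : ℕ) : intWalkCount S e n = 0 := stepCount_of_notMem he n

theorem intWalkCount_succ {D : ℕ} {S : Set (Fin D → ℤ)} (hS : S.Finite) {e : Fin D → ℤ}
    (he : 0 ≤ e) (n : ℕ) :
    intWalkCount S e (n + 1) = ∑ s ∈ hS.toFinset, intWalkCount S (e - s) n :=
  stepCount_succ hS he n

theorem append_nonneg_iff {i : Fin d → ℤ} {j : Fin δ → ℤ} :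
    0 ≤ Fin.append i j ↔ 0 ≤ i ∧ 0 ≤ j := by
  constructor
  · exact fun h => ⟨fun a => by simpa using h (Fin.castAdd δ a),
      fun a => by simpa using h (Fin.natAdd d a)⟩
  · rintro ⟨hi, hj⟩ a
    refine Fin.addCases (fun b => ?_) (fun b => ?_) a
    · simpa using hi b
    · simpa using hj b

theorem append_eq_zero_iff {i : Fin d → ℤ} {j : Fin δ → ℤ} :
    Fin.append i j = 0 ↔ i = 0 ∧ j = 0 := by
  constructor
  · exact fun h => ⟨funext fun a => by simpa using congrFun h (Fin.castAdd δ a),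
      funext fun a => by simpa using congrFun h (Fin.natAdd d a)⟩
  · rintro ⟨rfl, rfl⟩
    ext a
    refine Fin.addCases (fun b => ?_) (fun b => ?_) a <;> simp

theorem append_sub_append (i i' : Fin d → ℤ) (j j' : Fin δ → ℤ) :
    Fin.append i j - Fin.append i' j' = Fin.append (i - i') (j - j') := by
  ext a
  refine Fin.addCases (fun b => ?_) (fun b => ?_) a <;> simp

theorem append_injective : Function.Injective
    fun p : (Fin d → ℤ) × (Fin δ → ℤ) => Fin.append p.1 p.2 := by
  rintro ⟨i, j⟩ ⟨i', j'⟩ h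
  exact Prod.ext (funext fun a => by simpa using congrFun h (Fin.castAdd δ a))
    (funext fun a => by simpa using congrFun h (Fin.natAdd d a))

theorem finite_hadamardSteps (hU : U.Finite) (hV : V.Finite) (hT : T.Finite) :
    (hadamardSteps U V T).Finite :=
  (hU.image2 _ (Set.finite_singleton _)).union (hV.image2 _ hT)

/-- Since $0\notin T$, no step arises from both $U\times\{0\}$ and $V\times T$. -/
theorem sum_hadamardSteps (hU : U.Finite) (hV : V.Finite) (hT : T.Finite) (h0 : 0 ∉ T)
    (g : (Fin (d + δ) → ℤ) → ℕ) :
    ∑ s ∈ (finite_hadamardSteps hU hV hT).toFinset, g s =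
      ∑ u ∈ hU.toFinset, g (Fin.append u 0) +
        ∑ v ∈ hV.toFinset, ∑ τ ∈ hT.toFinset, g (Fin.append v τ) := by
  classical
  have h1 : (finite_hadamardSteps hU hV hT).toFinset =
      hU.toFinset.image (fun u => Fin.append u 0) ∪
        (hV.toFinset ×ˢ hT.toFinset).image (fun p => Fin.append p.1 p.2) := by
    ext s
    simp only [hadamardSteps, Set.Finite.mem_toFinset, Set.mem_union, Set.mem_image2,
      Finset.mem_union, Finset.mem_image, Finset.mem_product, Prod.exists, Set.mem_singleton_iff,
      exists_eq_left]
    constructor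
    · rintro (h | ⟨a, ha, b, hb, h⟩)
      exacts [Or.inl h, Or.inr ⟨a, b, ⟨ha, hb⟩, h⟩]
    · rintro (h | ⟨a, b, ⟨ha, hb⟩, h⟩)
      exacts [Or.inl h, Or.inr ⟨a, ha, b, hb, h⟩]
  rw [h1, Finset.sum_union, Finset.sum_image, Finset.sum_image (append_injective.injOn),
    Finset.sum_product]
  · intro u _ u' _ h
    exact congrArg Prod.fst (append_injective (a₁ := (u, 0)) (a₂ := (u', 0)) h)
  · rw [Finset.disjoint_left]
    intro s hs hs'
    obtain ⟨u, -, rfl⟩ := Finset.mem_image.1 hs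
    obtain ⟨p, hp, h⟩ := Finset.mem_image.1 hs'
    have h2 := congrArg Prod.snd (append_injective (a₁ := p) (a₂ := (u, 0)) h)
    refine h0 ?_
    rw [← show p.2 = 0 from h2]
    exact hT.mem_toFinset.1 (Finset.mem_product.1 hp).2

/-- A walk with Hadamard steps is a coloured walk together with a walk whose steps are attached to
the black steps. -/
theorem intWalkCount_hadamardSteps (hU : U.Finite) (hV : V.Finite) (hT : T.Finite) (h0 : 0 ∉ T)
    (i : Fin d → ℤ) (j : Fin δ → ℤ) (n : ℕ) :
    intWalkCount (hadamardSteps U V T) (Fin.append i j) n =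
      ∑ m ∈ Finset.range (n + 1), intColouredCount U V i m n * intWalkCount T j m := by
  classical
  induction n generalizing i j with
  | zero =>
    simp only [Nat.zero_add, Finset.sum_range_one, intWalkCount_zero, intColouredCount_zero,
      append_eq_zero_iff]
    by_cases hi : i = 0 <;> by_cases hj : j = 0 <;> simp [hi, hj]
  | succ n ih =>
    by_cases hi : 0 ≤ i
    swap
    · rw [intWalkCount_of_not_nonneg _ (mt append_nonneg_iff.1 (fun h => hi h.1)),
        Finset.sum_eq_zero fun m _ => by rw [intColouredCount_of_not_nonneg hi, zero_mul]]
    by_cases hj : 0 ≤ j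
    swap
    · rw [intWalkCount_of_not_nonneg _ (mt append_nonneg_iff.1 (fun h => hj h.2)),
        Finset.sum_eq_zero fun m _ => by rw [intWalkCount_of_not_nonneg T hj, mul_zero]]
    rw [intWalkCount_succ (finite_hadamardSteps hU hV hT) (append_nonneg_iff.2 ⟨hi, hj⟩),
      sum_hadamardSteps hU hV hT h0]
    simp only [append_sub_append, sub_zero, ih, intColouredCount_succ hU hV hi, add_mul,
      Finset.sum_add_distrib]
    congr 1
    -- White last step: the extra term $m=n+1$ asks for more black steps than steps.
    · rw [Finset.sum_comm, Finset.sum_range_succ _ (n + 1)]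
      simp only [Finset.sum_mul]
      rw [Finset.sum_eq_zero (s := hU.toFinset) fun u _ => by
        rw [intColouredCount_of_lt hU hV _ (Or.inr (by push_cast; omega)), zero_mul], add_zero]
    -- Black last step: the term $m=0$ asks for $-1$ black steps; for the others, the quadrant walk
    -- also loses its last step.
    · rw [Finset.sum_range_succ' _ (n + 1)]
      rw [Finset.sum_eq_zero (s := hV.toFinset) fun v _ =>
        intColouredCount_of_lt hU hV _ (Or.inl (by simp)), zero_mul, add_zero]
      simp only [intWalkCount_succ hT hj, Finset.sum_mul, Finset.mul_sum]
      simp only [Nat.cast_add, Nat.cast_one, add_sub_cancel_right]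
      rw [Finset.sum_comm, Finset.sum_comm (s := Finset.range (n + 1))]
      exact Finset.sum_congr rfl fun _ _ => Finset.sum_comm

end WalkCounts

/-! ### Functional equation and algebraicity of coloured walks. -/

section HalfLine

variable {U V : Set (Fin 1 → ℤ)}

open Classical in
theorem sum_smallSteps_one (hU : U ⊆ smallSteps 1) (hfin : U.Finite) (g : (Fin 1 → ℤ) → ℕ) :
    ∑ u ∈ hfin.toFinset, g u = (if (fun _ => -1) ∈ U then g fun _ => -1 else 0) +
      (if (fun _ => 0) ∈ U then g fun _ => 0 else 0) +
      (if (fun _ => 1) ∈ U then g fun _ => 1 else 0) := by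
  have h1 : hfin.toFinset =
      (({-1, 0, 1} : Finset ℤ).image fun δ (_ : Fin 1) => δ).filter (· ∈ U) := by
    ext u
    simp only [Set.Finite.mem_toFinset, Finset.mem_filter, Finset.mem_image]
    refine ⟨fun hu => ⟨⟨u 0, by simpa [smallSteps] using hU hu 0, ?_⟩, hu⟩, fun h => h.2⟩
    ext j
    rw [Subsingleton.elim j 0]
  have hinj : Function.Injective fun (δ : ℤ) (_ : Fin 1) => δ := fun a b h => congrFun h 0
  rw [h1, Finset.sum_filter, Finset.sum_image hinj.injOn, Finset.sum_insert (by simp),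
    Finset.sum_insert (by simp), Finset.sum_singleton, add_assoc]

theorem coeff_X_mul_eq {σ : Type} (j : σ) (F : MvPowerSeries σ ℚ) (n : σ →₀ ℕ) :
    coeff n (X j * F) = if n j = 0 then 0 else coeff (n - Finsupp.single j 1) F := by
  classical
  rw [X_def, coeff_monomial_mul]
  simp only [Finsupp.single_le_iff, one_mul, Nat.one_le_iff_ne_zero, ite_not]

/-- The generating function of coloured walks by end point, marking variable and length, where `κ`
gives the number of black steps in terms of the exponent of the marking variable and the length. -/
noncomputable def markedGF (U V : Set (Fin 1 → ℤ)) (κ : ℕ → ℕ → ℤ) :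
    MvPowerSeries (Fin 1 ⊕ Fin 2) ℚ :=
  fun m => (intColouredCount U V (fun _ => (m (Sum.inl 0) : ℤ))
    (κ (m (Sum.inr 0)) (m (Sum.inr 1))) (m (Sum.inr 1)) : ℚ)

theorem coeff_markedGF (κ : ℕ → ℕ → ℤ) (m : Fin 1 ⊕ Fin 2 →₀ ℕ) :
    coeff m (markedGF U V κ) = (intColouredCount U V (fun _ => (m (Sum.inl 0) : ℤ))
      (κ (m (Sum.inr 0)) (m (Sum.inr 1))) (m (Sum.inr 1)) : ℚ) := rfl

/-- `W` and `B` are the weights of a white and of a black step; `hW` and `hB` say that they change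
the mark as appending such a step does. This covers marking black steps ($W=1$, $B=v$) and marking
white ones ($W=v$, $B=1$). -/
theorem isAlgebraic_markedGF (hU : U ⊆ smallSteps 1) (hV : V ⊆ smallSteps 1) (κ : ℕ → ℕ → ℤ)
    (hκ : ∀ k, κ k 0 = 0 ↔ k = 0) (W B : MvPolynomial (Fin 1 ⊕ Fin 2) ℚ)
    (hWx : MvPolynomial.pderiv (Sum.inl 0) W = 0) (hBx : MvPolynomial.pderiv (Sum.inl 0) B = 0)
    (hW : ∀ m, coeff m ((W : MvPowerSeries _ ℚ) * markedGF U V κ) =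
      (intColouredCount U V (fun _ => (m (Sum.inl 0) : ℤ))
        (κ (m (Sum.inr 0)) (m (Sum.inr 1) + 1)) (m (Sum.inr 1)) : ℚ))
    (hB : ∀ m, coeff m ((B : MvPowerSeries _ ℚ) * markedGF U V κ) =
      (intColouredCount U V (fun _ => (m (Sum.inl 0) : ℤ))
        (κ (m (Sum.inr 0)) (m (Sum.inr 1) + 1) - 1) (m (Sum.inr 1)) : ℚ)) :
    IsAlgebraic (MvPolynomial (Fin 1 ⊕ Fin 2) ℚ) (markedGF U V κ) := by
  classical
  set x : Fin 1 ⊕ Fin 2 := Sum.inl 0 with hx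
  set t : Fin 1 ⊕ Fin 2 := Sum.inr 1 with ht
  have hxt : x ≠ t := by simp [hx, ht]
  have hUf := (finite_smallSteps 1).subset hU
  have hVf := (finite_smallSteps 1).subset hV
  let χ : Set (Fin 1 → ℤ) → ℤ → ℚ := fun Z δ => if (fun _ => δ) ∈ Z then 1 else 0
  let w : ℤ → MvPolynomial (Fin 1 ⊕ Fin 2) ℚ := fun δ =>
    MvPolynomial.C (χ U δ) * W + MvPolynomial.C (χ V δ) * B
  have hwx : ∀ δ, MvPolynomial.pderiv x (w δ) = 0 := by
    intro δ
    simp [w, hWx, hBx]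
  set F := markedGF U V κ with hF
  have hw : ∀ δ m, coeff m ((w δ : MvPowerSeries _ ℚ) * F) =
      χ U δ * intColouredCount U V (fun _ => (m x : ℤ)) (κ (m (Sum.inr 0)) (m t + 1)) (m t) +
      χ V δ * intColouredCount U V (fun _ => (m x : ℤ)) (κ (m (Sum.inr 0)) (m t + 1) - 1)
        (m t) := by
    intro δ m
    simp only [w, MvPolynomial.coe_add, MvPolynomial.coe_mul, MvPolynomial.coe_C, add_mul,
      mul_assoc, map_add, coeff_C_mul, hW, hB]
  refine isAlgebraic_of_kernel_equation hxt (hwx (-1)) (hwx 0) (hwx 1) ?_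
  -- Only monomials divisible by $x$ are compared, so the boundary term of walks stepping below $0$
  -- never appears; the rest is the last-step recurrence.
  rw [pderiv_eq_zero_iff]
  intro m
  have h1 : X x * F - X x - X t * ((w (-1) : MvPowerSeries _ ℚ) + (w 0 : MvPowerSeries _ ℚ) * X x +
        (w 1 : MvPowerSeries _ ℚ) * X x ^ 2) * F = X x * F - X x -
      X t * ((w (-1) : MvPowerSeries _ ℚ) * F + X x * ((w 0 : MvPowerSeries _ ℚ) * F) +
        X x * (X x * ((w 1 : MvPowerSeries _ ℚ) * F))) := by ring
  have h2 : coeff (m + Finsupp.single x 1) (X x : MvPowerSeries (Fin 1 ⊕ Fin 2) ℚ) =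
      if m = 0 then 1 else 0 := by
    rw [coeff_X]
    simp
  have h3 : ∀ G : MvPowerSeries (Fin 1 ⊕ Fin 2) ℚ,
      coeff (m + Finsupp.single x 1) (X x * G) = coeff m G := by
    intro G
    rw [add_comm, X_def, coeff_add_monomial_mul, one_mul]
  have htx : (Finsupp.single x 1 : Fin 1 ⊕ Fin 2 →₀ ℕ) t = 0 := Finsupp.single_eq_of_ne hxt.symm
  have hxt' : (Finsupp.single t 1 : Fin 1 ⊕ Fin 2 →₀ ℕ) x = 0 := Finsupp.single_eq_of_ne hxt
  have hvx : (Finsupp.single x 1 : Fin 1 ⊕ Fin 2 →₀ ℕ) (Sum.inr 0) = 0 :=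
    Finsupp.single_eq_of_ne (by simp [hx])
  have hvt : (Finsupp.single t 1 : Fin 1 ⊕ Fin 2 →₀ ℕ) (Sum.inr 0) = 0 :=
    Finsupp.single_eq_of_ne (by simp [ht])
  rw [h1, map_sub, map_sub, h2, h3, coeff_X_mul_eq, hF, coeff_markedGF, ← hF]
  by_cases hmt : m t = 0
  · have h0 : (m + Finsupp.single x 1 : Fin 1 ⊕ Fin 2 →₀ ℕ) t = 0 := by simp [htx, hmt]
    rw [if_pos h0, sub_zero, ← ht, ← hx, hmt, intColouredCount_zero]
    have h4 : ((fun _ => (m x : ℤ)) = (0 : Fin 1 → ℤ) ∧ κ (m (Sum.inr 0)) 0 = 0) ↔ m = 0 := by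
      rw [hκ]
      constructor
      · rintro ⟨ha, hb⟩
        have ha' : m x = 0 := Int.natCast_eq_zero.1 (congrFun ha 0)
        ext j
        rcases j with j | j
        · rw [Subsingleton.elim j 0]; exact ha'
        · fin_cases j
          · exact hb
          · exact hmt
      · rintro rfl
        exact ⟨by ext; simp, by simp⟩
    simp only [h4]
    split_ifs <;> simp
  · obtain ⟨m, rfl⟩ : ∃ m', m = m' + Finsupp.single t 1 :=
      ⟨m - Finsupp.single t 1, (tsub_add_cancel_of_le
        (Finsupp.single_le_iff.2 (Nat.one_le_iff_ne_zero.2 hmt))).symm⟩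
    have h4 : coeff m (X x * ((w 1 : MvPowerSeries _ ℚ) * F)) =
        χ U 1 * intColouredCount U V (fun _ => (m x : ℤ) - 1)
          (κ (m (Sum.inr 0)) (m t + 1)) (m t) +
        χ V 1 * intColouredCount U V (fun _ => (m x : ℤ) - 1)
          (κ (m (Sum.inr 0)) (m t + 1) - 1) (m t) := by
      rw [coeff_X_mul_eq]
      split_ifs with h0
      · have hneg : ¬ (0 : Fin 1 → ℤ) ≤ fun _ => (m x : ℤ) - 1 := fun h => by
          have := h 0
          simp [h0] at this
        simp [intColouredCount_of_not_nonneg hneg]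
      · rw [hw]
        simp [htx, hvx, Nat.cast_sub (Nat.one_le_iff_ne_zero.2 h0)]
    have h5 : m + Finsupp.single t 1 + Finsupp.single x 1 - Finsupp.single t 1 =
        m + Finsupp.single x 1 := by
      rw [add_right_comm, add_tsub_cancel_right]
    have h6 : (m + Finsupp.single t 1 : Fin 1 ⊕ Fin 2 →₀ ℕ) ≠ 0 := fun h => hmt (by rw [h]; rfl)
    have h7 : (0 : Fin 1 → ℤ) ≤ fun _ => (m x : ℤ) := fun _ => Int.natCast_nonneg _
    have h3' : ∀ G : MvPowerSeries (Fin 1 ⊕ Fin 2) ℚ,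
        coeff (m + Finsupp.single x 1) (X x * G) = coeff m G := by
      intro G
      rw [add_comm, X_def, coeff_add_monomial_mul, one_mul]
    have h8 : (m + Finsupp.single t 1 + Finsupp.single x 1 : Fin 1 ⊕ Fin 2 →₀ ℕ) t ≠ 0 := by simp
    rw [if_neg h6, if_neg h8, h5, map_add, map_add, h3', h3', hw, hw, h4]
    simp only [← hx, ← ht, Finsupp.add_apply, htx, hxt', hvx, hvt, Finsupp.single_eq_same, add_zero]
    rw [intColouredCount_succ hUf hVf h7, sum_smallSteps_one hU hUf, sum_smallSteps_one hV hVf]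
    simp only [χ, ite_mul, one_mul, zero_mul, Pi.sub_def, sub_neg_eq_add, sub_zero]
    push_cast
    ring

theorem colouredGF_eq_markedGF : colouredGF U V = markedGF U V fun k _ => k := by
  ext m
  rw [coeff_markedGF, coeff_apply, colouredGF, colouredCount_eq_intColouredCount]
  congr 3
  ext j
  rw [Subsingleton.elim j 0]

theorem isAlgebraic_colouredGF (hU : U ⊆ smallSteps 1) (hV : V ⊆ smallSteps 1) :
    IsAlgebraic (MvPolynomial (Fin 1 ⊕ Fin 2) ℚ) (colouredGF U V) := by
  have hUf := (finite_smallSteps 1).subset hU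
  have hVf := (finite_smallSteps 1).subset hV
  rw [colouredGF_eq_markedGF]
  refine isAlgebraic_markedGF hU hV _ (by simp) 1 (MvPolynomial.X (Sum.inr 0)) (by simp)
    (by simp [MvPolynomial.pderiv_X]) (fun m => ?_) fun m => ?_
  · rw [MvPolynomial.coe_one, one_mul, coeff_markedGF]
  · rw [MvPolynomial.coe_X, coeff_X_mul_eq]
    split_ifs with h
    · rw [intColouredCount_of_lt hUf hVf _ (Or.inl (by simp [h])), Nat.cast_zero]
    · rw [coeff_markedGF]
      simp [Nat.cast_sub (Nat.one_le_iff_ne_zero.2 h)]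

/-- The generating function of coloured walks in which the white steps, instead of the black ones,
are marked. -/
noncomputable def whiteGF (U V : Set (Fin 1 → ℤ)) : MvPowerSeries (Fin 1 ⊕ Fin 2) ℚ :=
  markedGF U V fun k n => n - k

theorem isAlgebraic_whiteGF (hU : U ⊆ smallSteps 1) (hV : V ⊆ smallSteps 1) :
    IsAlgebraic (MvPolynomial (Fin 1 ⊕ Fin 2) ℚ) (whiteGF U V) := by
  have hUf := (finite_smallSteps 1).subset hU
  have hVf := (finite_smallSteps 1).subset hV
  refine isAlgebraic_markedGF hU hV _ (by simp) (MvPolynomial.X (Sum.inr 0)) 1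
    (by simp [MvPolynomial.pderiv_X]) (by simp) (fun m => ?_) fun m => ?_
  · rw [MvPolynomial.coe_X, coeff_X_mul_eq]
    split_ifs with h
    · rw [intColouredCount_of_lt hUf hVf _ (Or.inr (by push_cast; omega)), Nat.cast_zero]
    · rw [coeff_markedGF]
      have h1 : ((m (Sum.inr 1) : ℕ) : ℤ) - ((m (Sum.inr 0) - 1 : ℕ) : ℤ) =
          (m (Sum.inr 1) : ℤ) + 1 - (m (Sum.inr 0) : ℕ) := by omega
      simp [h1]
  · rw [MvPolynomial.coe_one, one_mul, coeff_markedGF]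
    have h1 : ((m (Sum.inr 1) + 1 : ℕ) : ℤ) - (m (Sum.inr 0) : ℕ) - 1 =
        (m (Sum.inr 1) : ℤ) - (m (Sum.inr 0) : ℕ) := by omega
    rw [h1]

end HalfLine

/-! ### The octant series as a diagonal. -/

section Hadamard

variable {U V : Set (Fin 1 → ℤ)} {T : Set (Fin 2 → ℤ)}

/-- The variables `x`, `v`, `t` of coloured walks among those of the octant and a new one. -/
def colouredVars : Fin 1 ⊕ Fin 2 ↪ Option (Fin (1 + 2) ⊕ Unit) where
  toFun := Sum.elim (fun i => some (Sum.inl (Fin.castAdd 2 i)))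
    ![none, some (Sum.inr ())]
  inj' := by decide

/-- The variables `y`, `z` and the length variable of quadrant walks among those of the octant and
a new one. -/
def quadrantVars : Fin 2 ⊕ Unit ↪ Option (Fin (1 + 2) ⊕ Unit) where
  toFun := Sum.elim (fun j => some (Sum.inl (Fin.natAdd 1 j))) fun _ => none
  inj' := by decide

/-- The octant exponent `m` restricted to the variables of a coloured walk with `k` white steps. -/
noncomputable def colouredExp (m : Fin (1 + 2) ⊕ Unit →₀ ℕ) (k : ℕ) : Fin 1 ⊕ Fin 2 →₀ ℕ :=
  Finsupp.equivFunOnFinite.symm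
    (Sum.elim (fun i => m (Sum.inl (Fin.castAdd 2 i))) ![k, m (Sum.inr ())])

/-- The octant exponent `m` restricted to the variables of a quadrant walk of length `l`. -/
noncomputable def quadrantExp (m : Fin (1 + 2) ⊕ Unit →₀ ℕ) (l : ℕ) : Fin 2 ⊕ Unit →₀ ℕ :=
  Finsupp.equivFunOnFinite.symm
    (Sum.elim (fun j => m (Sum.inl (Fin.natAdd 1 j))) fun _ => l)

/-- The two factors share only the new variable, so a factorisation of a diagonal monomial is a
splitting of the length into white steps and a quadrant length `l`. -/
theorem embDomain_add_embDomain_eq_iff (m : Fin (1 + 2) ⊕ Unit →₀ ℕ) (a : Fin 1 ⊕ Fin 2 →₀ ℕ)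
    (b : Fin 2 ⊕ Unit →₀ ℕ) :
    a.embDomain colouredVars + b.embDomain quadrantVars = diagExp (Sum.inr ()) m ↔
      ∃ l ≤ m (Sum.inr ()), a = colouredExp m (m (Sum.inr ()) - l) ∧ b = quadrantExp m l := by
  have hq : ∀ i : Fin 1, some (Sum.inl (Fin.castAdd 2 i)) ∉ Set.range quadrantVars := by
    rintro i ⟨j | j, hj⟩
    · revert i j; decide
    · revert i j; decide
  have hq' : some (Sum.inr ()) ∉ Set.range quadrantVars := by
    rintro ⟨j | j, hj⟩
    · revert j; decide
    · revert j; decide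
  have hc : ∀ i : Fin 2, some (Sum.inl (Fin.natAdd 1 i)) ∉ Set.range colouredVars := by
    rintro i ⟨j | j, hj⟩
    · revert i j; decide
    · revert i j; decide
  have e1 : ∀ i : Fin 1, a.embDomain colouredVars (some (Sum.inl (Fin.castAdd 2 i))) =
      a (Sum.inl i) := fun i => Finsupp.embDomain_apply_self colouredVars a (Sum.inl i)
  have e2 : a.embDomain colouredVars none = a (Sum.inr 0) :=
    Finsupp.embDomain_apply_self colouredVars a (Sum.inr 0)
  have e3 : a.embDomain colouredVars (some (Sum.inr ())) = a (Sum.inr 1) :=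
    Finsupp.embDomain_apply_self colouredVars a (Sum.inr 1)
  have e4 : ∀ i : Fin 2, b.embDomain quadrantVars (some (Sum.inl (Fin.natAdd 1 i))) =
      b (Sum.inl i) := fun i => Finsupp.embDomain_apply_self quadrantVars b (Sum.inl i)
  have e5 : b.embDomain quadrantVars none = b (Sum.inr ()) :=
    Finsupp.embDomain_apply_self quadrantVars b (Sum.inr ())
  constructor
  · intro h
    have h' := fun p => DFunLike.congr_fun h p
    simp only [Finsupp.add_apply] at h'
    have h1 := h' none
    rw [e2, e5, diagExp_none] at h1
    have h2 := h' (some (Sum.inr ()))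
    rw [e3, Finsupp.embDomain_of_notMem_range _ _ _ hq', diagExp_some, add_zero] at h2
    refine ⟨b (Sum.inr ()), by omega, ?_, ?_⟩
    · ext (i | i)
      · have h3 := h' (some (Sum.inl (Fin.castAdd 2 i)))
        rw [e1, Finsupp.embDomain_of_notMem_range _ _ _ (hq i), diagExp_some, add_zero] at h3
        exact h3
      · fin_cases i
        · simp only [colouredExp, Finsupp.equivFunOnFinite_symm_apply_apply, Sum.elim_inr]
          exact Nat.eq_sub_of_add_eq h1
        · exact h2
    · ext (i | i)
      · have h3 := h' (some (Sum.inl (Fin.natAdd 1 i)))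
        rw [e4, Finsupp.embDomain_of_notMem_range _ _ _ (hc i), diagExp_some, zero_add] at h3
        exact h3
      · rfl
  · rintro ⟨l, hl, rfl, rfl⟩
    ext (_ | i | i)
    · rw [Finsupp.add_apply, e2, e5, diagExp_none]
      exact Nat.sub_add_cancel hl
    · rw [Finsupp.add_apply, diagExp_some]
      refine Fin.addCases (m := 1) (n := 2) (fun j => ?_) (fun j => ?_) i
      · rw [e1, Finsupp.embDomain_of_notMem_range _ _ _ (hq j), add_zero]
        rfl
      · rw [e4, Finsupp.embDomain_of_notMem_range _ _ _ (hc j), zero_add]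
        rfl
    · rw [Finsupp.add_apply, diagExp_some, e3, Finsupp.embDomain_of_notMem_range _ _ _ hq']
      rfl

theorem walkGF_hadamardSteps (hU : U.Finite) (hV : V.Finite) (hT : T.Finite) (h0 : 0 ∉ T) :
    walkGF (hadamardSteps U V T) = diagonal (Sum.inr ())
      (rename colouredVars (whiteGF U V) * rename quadrantVars (walkGF T)) := by
  classical
  ext m
  rw [coeff_diagonal, coeff_mul, coeff_apply, walkGF, walkCount_eq_intWalkCount]
  have happ : (fun i => (m (Sum.inl i) : ℤ)) =
      Fin.append (fun i => (m (Sum.inl (Fin.castAdd 2 i)) : ℤ))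
        fun j => (m (Sum.inl (Fin.natAdd 1 j)) : ℤ) := by
    ext i
    refine Fin.addCases (fun j => ?_) (fun j => ?_) i <;> simp
  rw [happ, intWalkCount_hadamardSteps hU hV hT h0, Nat.cast_sum]
  refine Finset.sum_of_injOn (fun l => ((colouredExp m (m (Sum.inr ()) - l)).embDomain colouredVars,
    (quadrantExp m l).embDomain quadrantVars)) ?_ ?_ ?_ ?_
  · intro l _ l' _ h
    have h1 := Finsupp.embDomain_injective _ (congrArg Prod.snd h)
    exact DFunLike.congr_fun h1 (Sum.inr ())
  · intro l hl
    rw [Finset.mem_coe, Finset.mem_range] at hl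
    exact Finset.mem_coe.2 (Finset.HasAntidiagonal.mem_antidiagonal.2
      ((embDomain_add_embDomain_eq_iff m _ _).2 ⟨l, by omega, rfl, rfl⟩))
  -- A nonzero term needs exponents supported on the variables of each factor, which forces the pair
  -- into the image.
  · rintro ⟨p, q⟩ hpq hnot
    rw [Finset.HasAntidiagonal.mem_antidiagonal] at hpq
    by_contra hne
    obtain ⟨hp, hq⟩ := mul_ne_zero_iff.1 hne
    obtain ⟨a, rfl⟩ := exists_embDomain_eq colouredVars (m := p) fun j hj => by
      by_contra h
      exact hp (coeff_rename_eq_zero_of_ne colouredVars hj h)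
    obtain ⟨b, rfl⟩ := exists_embDomain_eq quadrantVars (m := q) fun j hj => by
      by_contra h
      exact hq (coeff_rename_eq_zero_of_ne quadrantVars hj h)
    obtain ⟨l, hl, rfl, rfl⟩ := (embDomain_add_embDomain_eq_iff m a b).1 hpq
    exact hnot ⟨l, Finset.mem_coe.2 (Finset.mem_range.2 (by omega)), rfl⟩
  · intro l hl
    rw [Finset.mem_range] at hl
    rw [coeff_embDomain_rename, coeff_embDomain_rename, whiteGF, coeff_markedGF, coeff_apply, walkGF,
      walkCount_eq_intWalkCount]
    have h1 : ((m (Sum.inr ()) : ℕ) : ℤ) - ((m (Sum.inr ()) - l : ℕ) : ℤ) = l := by omega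
    have h2 : (fun i => (m (Sum.inl (Fin.castAdd 2 i)) : ℤ)) =
        fun _ : Fin 1 => (m (Sum.inl 0) : ℤ) := by
      ext i
      rw [Subsingleton.elim i 0]
      rfl
    simp [colouredExp, quadrantExp, h1, h2]

end Hadamard

end OctantWalks

theorem mainTheorem7 (S : Set (Fin 3 → ℤ))
    (U V : Set (Fin 1 → ℤ)) (T : Set (Fin 2 → ℤ))
    (hU : U ⊆ OctantWalks.smallSteps 1 \ {0})
    (hV : V ⊆ OctantWalks.smallSteps 1)
    (hT : T ⊆ OctantWalks.smallSteps 2 \ {0})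
    (hS : S = OctantWalks.hadamardSteps U V T) :
    IsAlgebraic (MvPolynomial (Fin 1 ⊕ Fin 2) ℚ) (OctantWalks.colouredGF U V) ∧
      (OctantWalks.DFinite (OctantWalks.walkGF T) →
        OctantWalks.DFinite (OctantWalks.walkGF S)) := by
  have hU' : U ⊆ OctantWalks.smallSteps 1 := fun u hu => (hU hu).1
  refine ⟨OctantWalks.isAlgebraic_colouredGF hU' hV, fun hTD => ?_⟩
  subst hS
  have hGF := OctantWalks.walkGF_hadamardSteps ((OctantWalks.finite_smallSteps 1).subset hU')
    ((OctantWalks.finite_smallSteps 1).subset hV)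
    ((OctantWalks.finite_smallSteps 2).subset fun τ hτ => (hT hτ).1) (fun h => (hT h).2 rfl)
  have hD := ((OctantWalks.holonomic_rename OctantWalks.colouredVars
    (OctantWalks.Holonomic.of_isAlgebraic (OctantWalks.isAlgebraic_whiteGF hU' hV))).mul
    (OctantWalks.holonomic_rename OctantWalks.quadrantVars hTD.holonomic)).dFinite_diagonal
    (Sum.inr ())
  rw [← hGF] at hD
  exact hD
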